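/- **Setting.** Let $d\ge 0$, let $(\Omega,\mathcal F,\pi)$ be a probability space with a measurable, measure preserving, ergodic action $(\tau_x)_{x\in\mathbb Z^d}$ of $\mathbb Z^d$, and let $\mathcal N=\{k\in\mathbb Z^d:|k|=1\}$. Let $p_k:\Omega\to[0,\infty)$, $k\in\mathcal N$, be measurable with $\sum_k p_k(\omega)=\sum_k p_{-k}(\tau_k\omega)$ a.s., and write $$s_k(\omega)=\tfrac12\big(p_k(\omega)+p_{-k}(\tau_k\omega)\big),\qquad b_k(\omega)=\tfrac12\big(p_k(\omega)-p_{-k}(\tau_k\omega)\big),\qquad r_k=\sqrt{s_k}.$$ Assume that $s_k>0$ a.s. and that $b$ is in divergence form: $b_k=\sum_{l\in\mathcal N}h_{k,l}$ a.s. for measurable $h_{k,l}:\Omega\to\mathbb R$ with $h_{k,l}(\omega)=-h_{-k,l}(\tau_k\omega)=-h_{k,-l}(\tau_l\omega)=-h_{l,k}(\omega)$ a.s. **Spaces** (functions are identified if they agree a.s.). A vector field is a family $u=(u_k)_{k\in\mathcal N}$ of measurable functions with $u_k(\omega)+u_{-k}(\tau_k\omega)=0$ a.s.; it is a gradient field if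 moreover $u_k(\omega)+u_l(\tau_k\omega)=u_l(\omega)+u_k(\tau_l\omega)$ a.s. for all $k,l$. For a family $u=(u_k)_{k\in\mathcal N}$ let $\|u\|_q^q=\frac12\sum_k\int|u_k|^q\,d\pi$ for $q=1,2$. Let $\mathcal V_2$ be the space of the vector fields in $L^2(\pi)$, $\mathcal U_q$ the space of the gradient fields in $L^q(\pi)$ with $\int u_k\,d\pi=0$ for all $k$, and $\mathcal L_q=\{f\in L^q(\pi):\int f\,d\pi=0\}$. Put $(Ru)_k=r_ku_k$ and $(\nabla g)_k(\omega)=g(\tau_k\omega)-g(\omega)$. For $r_k\in L^2(\pi)$ let $\mathcal K_2$ be the closure of $R\,\mathcal U_\infty$ in $(\mathcal V_2,\|\cdot\|_2)$, and let $$\mathcal H_-=\{f\in\mathcal L_1:\|f\|_-<\infty\},\qquad \|f\|_-^2=\sup_{g\in\mathcal L_\infty}\Big(2\int fg\,d\pi-\|R\nabla g\|_2^2\Big).$$ **Proposition.** Assume $r_k,\ r_k^{-1}\in L^2(\pi)$ for all $k\in\mathcal N$. Then: 1. $R^{-1}\mathcal K_2\subset\mathcal U_1$, that is, the elements of $R^{-1}\mathcal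 K_2$ are integrable centred gradient fields. 2. For every $\varphi\in\mathcal H_-$ there is $w\in R^{-1}\mathcal K_2$ with $$\sum_{k\in\mathcal N}p_kw_k=\varphi\quad\text{a.s.},\qquad \|Rw\|_2\le\|\varphi\|_-,\qquad \|w\|_1\le\|r^{-1}\|_2\,\|\varphi\|_-,\qquad \|r^{-1}\|_2^2=\tfrac12\sum_k\int r_k^{-2}\,d\pi .$$ 3. If moreover $r_l^{-1}h_{k,l}\in L^2(\pi)$ for all $k,l\in\mathcal N$, then for every $\varphi\in\mathcal H_-$ the solution $w\in R^{-1}\mathcal K_2$ of $\sum_kp_kw_k=\varphi$ is unique (up to a.s. equality); hence it is the one in 2. -/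

import Mathlib

open MeasureTheory
open scoped ENNReal

namespace RWRE

/-- The finite set `𝒩 = {k ∈ ℤ^d : |k| = 1}` of unit steps of the lattice `ℤ^d`. -/
noncomputable def steps (d : ℕ) : Finset (Fin d → ℤ) :=
  (Fintype.piFinset fun _ => Finset.Icc (-1 : ℤ) 1).filter fun k => ∑ i, |k i| = 1

/-- The bounding box in the definition of `steps` is no restriction. -/
theorem mem_steps {d : ℕ} (k : Fin d → ℤ) : k ∈ steps d ↔ ∑ i, |k i| = 1 := by
  unfold steps
  rw [Finset.mem_filter, Fintype.mem_piFinset]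
  refine ⟨fun h => h.2, fun h => ⟨fun i => ?_, h⟩⟩
  have hi : |k i| ≤ ∑ j, |k j| :=
    Finset.single_le_sum (f := fun j => |k j|) (fun j _ => abs_nonneg (k j)) (Finset.mem_univ i)
  rw [h] at hi
  exact Finset.mem_Icc.mpr (abs_le.mp hi)

/-- The type of unit steps. -/
abbrev Step (d : ℕ) : Type := {k : Fin d → ℤ // k ∈ steps d}

/-- The opposite step `-k`. -/
instance (d : ℕ) : Neg (Step d) :=
  ⟨fun k => ⟨-k.1, (mem_steps _).mpr (by
    have h := (mem_steps _).mp k.2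
    simpa using h)⟩⟩

section Fields

variable {d : ℕ} {Ω : Type*} [MeasurableSpace Ω] [AddAction (Fin d → ℤ) Ω]

/-- The lattice gradient `(∇ f)_k(ω) = f(τ_k ω) - f(ω)`. -/
def grad (f : Ω → ℝ) (k : Step d) (ω : Ω) : ℝ := f (k.1 +ᵥ ω) - f ω

/-- `𝓥`: vector fields, `u_k(ω) + u_{-k}(τ_k ω) = 0` almost surely. -/
def IsVectorField (π : Measure Ω) (u : Step d → Ω → ℝ) : Prop :=
  (∀ k, AEMeasurable (u k) π) ∧ ∀ k, ∀ᵐ ω ∂π, u k ω + u (-k) (k.1 +ᵥ ω) = 0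

/-- `𝓤`: gradient (rotation-free) vector fields,
`u_k(ω) + u_l(τ_k ω) = u_l(ω) + u_k(τ_l ω)` almost surely. -/
def IsGradientField (π : Measure Ω) (u : Step d → Ω → ℝ) : Prop :=
  IsVectorField π u ∧
    ∀ k l, ∀ᵐ ω ∂π, u k ω + u l (k.1 +ᵥ ω) = u l ω + u k (l.1 +ᵥ ω)

/-- `𝓛_q`: centred scalar fields in `L^q`. -/
def MemScalar (π : Measure Ω) (q : ℝ≥0∞) (f : Ω → ℝ) : Prop :=
  MemLp f q π ∧ ∫ ω, f ω ∂π = 0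

/-- `𝓥_q`: vector fields in `L^q` (not necessarily centred). -/
def MemVector (π : Measure Ω) (q : ℝ≥0∞) (u : Step d → Ω → ℝ) : Prop :=
  IsVectorField π u ∧ ∀ k, MemLp (u k) q π

/-- `𝓤_q`: centred gradient fields in `L^q`. -/
def MemGradient (π : Measure Ω) (q : ℝ≥0∞) (u : Step d → Ω → ℝ) : Prop :=
  IsGradientField π u ∧ (∀ k, MemLp (u k) q π) ∧ ∀ k, ∫ ω, u k ω ∂π = 0

/-- `‖u‖_1 = (1/2) ∑_k ‖u_k‖_1`. -/
noncomputable def normOne (π : Measure Ω) (u : Step d → Ω → ℝ) : ℝ :=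
  (1 / 2) * ∑ k, ∫ ω, |u k ω| ∂π

/-- `‖u‖_2`, where `‖u‖_2 ^ 2 = (1/2) ∑_k ‖u_k‖_2 ^ 2`. -/
noncomputable def normTwo (π : Measure Ω) (u : Step d → Ω → ℝ) : ℝ :=
  Real.sqrt ((1 / 2) * ∑ k, ∫ ω, (u k ω) ^ 2 ∂π)

end Fields

/-- Bistochastic jump rates `p` of a nearest neighbour random walk in random environment, whose
conductances are positive (weak ellipticity) and whose antisymmetric part is in divergence form,
with stream tensor `h`. -/
structure Environment (d : ℕ) (Ω : Type*) [MeasurableSpace Ω] [AddAction (Fin d → ℤ) Ω]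
    (π : Measure Ω) where
  /-- The jump rates `p_k(ω)`. -/
  p : Step d → Ω → ℝ
  /-- The stream tensor `h_{k,l}(ω)`. -/
  h : Step d → Step d → Ω → ℝ
  measurable_p : ∀ k, Measurable (p k)
  measurable_h : ∀ k l, Measurable (h k l)
  p_nonneg : ∀ k ω, 0 ≤ p k ω
  bistochastic : ∀ᵐ ω ∂π, ∑ k, p k ω = ∑ k : Step d, p (-k) (k.1 +ᵥ ω)
  weakly_elliptic : ∀ k : Step d, ∀ᵐ ω ∂π, 0 < (p k ω + p (-k) (k.1 +ᵥ ω)) / 2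
  h_neg_left : ∀ k l : Step d, ∀ᵐ ω ∂π, h k l ω = -h (-k) l (k.1 +ᵥ ω)
  h_neg_right : ∀ k l : Step d, ∀ᵐ ω ∂π, h k l ω = -h k (-l) (l.1 +ᵥ ω)
  h_swap : ∀ k l : Step d, ∀ᵐ ω ∂π, h k l ω = -h l k ω
  divergence_form : ∀ k : Step d, ∀ᵐ ω ∂π,
    (p k ω - p (-k) (k.1 +ᵥ ω)) / 2 = ∑ l, h k l ω

namespace Environment

variable {d : ℕ} {Ω : Type*} [MeasurableSpace Ω] [AddAction (Fin d → ℤ) Ω] {π : Measure Ω}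

/-- The conductances `s_k(ω) = (p_k(ω) + p_{-k}(τ_k ω)) / 2`. -/
noncomputable def s (E : Environment d Ω π) (k : Step d) (ω : Ω) : ℝ :=
  (E.p k ω + E.p (-k) (k.1 +ᵥ ω)) / 2

/-- `r_k = √ s_k`. -/
noncomputable def r (E : Environment d Ω π) (k : Step d) (ω : Ω) : ℝ := Real.sqrt (E.s k ω)

/-- The operator `R`, `(R u)_k = r_k u_k`. -/
noncomputable def mulR (E : Environment d Ω π) (u : Step d → Ω → ℝ) (k : Step d) (ω : Ω) : ℝ :=
  E.r k ω * u k ω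

/-- The operator `R⁻¹`, `(R⁻¹ u)_k = (r_k)⁻¹ u_k`. -/
noncomputable def mulRInv (E : Environment d Ω π) (u : Step d → Ω → ℝ) (k : Step d) (ω : Ω) : ℝ :=
  (E.r k ω)⁻¹ * u k ω

/-- `𝓚_2`: the closure of `R 𝓤_∞` in `(𝓥_2, ‖·‖_2)`. -/
def MemK2 (E : Environment d Ω π) (u : Step d → Ω → ℝ) : Prop :=
  MemVector π 2 u ∧
    ∀ ε : ℝ, 0 < ε → ∃ v : Step d → Ω → ℝ, MemGradient π ∞ v ∧ normTwo π (u - E.mulR v) < ε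

/-- `R⁻¹ 𝓚_2` (fields are considered up to almost sure equality). -/
def MemRInvK2 (E : Environment d Ω π) (w : Step d → Ω → ℝ) : Prop :=
  ∃ u, E.MemK2 u ∧ ∀ k, w k =ᵐ[π] E.mulRInv u k

/-- The values `2 ⟨f, g⟩ - ‖R ∇ g‖_2 ^ 2`, `g ∈ 𝓛_∞`, whose supremum is `‖f‖_- ^ 2`. -/
def dualValues (E : Environment d Ω π) (f : Ω → ℝ) : Set ℝ :=
  {a | ∃ g : Ω → ℝ, MemScalar π ∞ g ∧
    a = 2 * ∫ ω, f ω * g ω ∂π - normTwo π (E.mulR (grad g)) ^ 2}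

/-- `𝓗_-`: the fields `f ∈ 𝓛_1` with `‖f‖_- < ∞`. -/
def MemHMinus (E : Environment d Ω π) (f : Ω → ℝ) : Prop :=
  MemScalar π 1 f ∧ BddAbove (E.dualValues f)

/-- `‖f‖_-`, the norm dual to the Dirichlet norm `‖g‖_+ = ‖R ∇ g‖_2` of the symmetric part
of the generator. -/
noncomputable def normMinus (E : Environment d Ω π) (f : Ω → ℝ) : ℝ :=
  Real.sqrt (sSup (E.dualValues f))

/-- The equation `∑_k p_k w_k = φ`, almost surely. -/
def SolvesHarmonic (E : Environment d Ω π) (w : Step d → Ω → ℝ) (φ : Ω → ℝ) : Prop :=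
  ∀ᵐ ω ∂π, ∑ k, E.p k ω * w k ω = φ ω

end Environment

end RWRE

namespace RWRE

/-! Existence is a Lax–Milgram argument. Tested against bounded `g`, the equation `∑_k p_k w_k = φ`
becomes `⟨R w, T g⟩ = ∫ φ g` with `T g = (p_k g / r_k)_k`. Bistochasticity gives `⟨R∇g, T g⟩ = -½
‖R∇g‖²` (`inner_gradMap_driftMap`), and `‖φ‖_-` bounds the right-hand side by the Dirichlet norm of
`g`. Hence `exists_forall_inner_eq_of_coercive` yields `R w` in the closure of the fields `R∇g`,
with the stated bound.

The space `𝓚_2` is built from all bounded centred gradient fields, but by ergodicity it is the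
closure of the `R∇g` alone (`toFields_mulR_mem_gradClosure`): a functional that kills all `R∇g` has
the same value on all translates of such a field, and convex combinations of these translates tend
to zero. So `R⁻¹𝓚_2` consists of energy limits of gradients. As `r⁻¹ ∈ L²`, these are also `L¹`
limits, which preserve the gradient relations and zero mean.

For uniqueness, let `w` be a difference of two solutions. It suffices that `∑_k ∫ p_k w_k² = 0`. The
potential of `w` need not be stationary, so the argument runs on `ℤ^d × Ω`, where the increments of
an approximate potential `f` form a function with gradient `∇f`. It is tested with a box average `θ`
of side `N` and a convex function that is quadratic up to `M = εN` and linear beyond. The Bregman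
remainder of that function bounds the energy from below. Because `b` is the divergence of `h`, the
flux through the boundary of the box is of order `M / N = ε`. The increments over the box are small
compared with `M`, since `w` is an `L¹` limit of gradients of bounded functions. The estimate is
`energy_le`; `EnergyLimit.energy_eq_zero` chooses the parameters. -/

open Filter Topology in
theorem ae_eq_const_of_forall_vadd_ae_eq (G : Type*) {Ω : Type*} [MeasurableSpace Ω]
    {π : Measure Ω} [VAdd G Ω] [ErgodicVAdd G Ω π] {f : Ω → ℝ} (hf : AEMeasurable f π)
    (hinv : ∀ x : G, (fun ω => f (x +ᵥ ω)) =ᵐ[π] f) : ∃ c : ℝ, f =ᵐ[π] fun _ => c := by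
  -- Every level set is almost invariant, hence null or conull; measurable sets separate the points
  -- of `ℝ`.
  refine exists_eventuallyEq_const_of_forall_separating MeasurableSet fun U hU => ?_
  have h := aeconst_of_forall_preimage_vadd_ae_eq G (s := f ⁻¹' U) (hf.nullMeasurable hU)
    fun x => ((hinv x).mono fun ω hω => by
      change (f (x +ᵥ ω) ∈ U) = (f ω ∈ U)
      rw [show f (x +ᵥ ω) = f ω from hω])
  exact Filter.eventuallyConst_set'.1 h |>.elim (fun h => Or.inr (by
      filter_upwards [h] with ω hω using fun h' => by
        have : (f ⁻¹' U) ω := h'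
        rw [hω] at this; exact this)) (fun h => Or.inl (by
      filter_upwards [h] with ω hω
      have : (f ⁻¹' U) ω := by rw [hω]; trivial
      exact this))

/-! ### Hilbert space tools. -/

section Hilbert

variable {H : Type*} [NormedAddCommGroup H] [InnerProductSpace ℝ H]

/-- A family of linear isometries preserving a nonempty set has a common fixed point in the closed
convex hull of that set, namely the element of minimal norm. -/
theorem exists_fixed_mem_closure_convexHull [CompleteSpace H] {ι : Type*} (U : ι → H →ₗᵢ[ℝ] H) {S : Set H}
    (hS : S.Nonempty) (hU : ∀ i, ∀ v ∈ S, U i v ∈ S) :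
    ∃ v ∈ closure (convexHull ℝ S), ∀ i, U i v = v := by
  have hconv : Convex ℝ (closure (convexHull ℝ S)) := (convex_convexHull ℝ S).closure
  obtain ⟨v, hv, hmin⟩ := exists_norm_eq_iInf_of_complete_convex
    (hS.mono ((subset_convexHull ℝ S).trans subset_closure)) isClosed_closure.isComplete hconv 0
  refine ⟨v, hv, fun i => ?_⟩
  have hmem : U i v ∈ closure (convexHull ℝ S) := by
    refine map_mem_closure (U i).continuous hv fun y hy => ?_
    have h1 : U i y ∈ (U i).toLinearMap '' convexHull ℝ S := ⟨y, hy, rfl⟩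
    rw [LinearMap.image_convexHull] at h1
    refine convexHull_mono ?_ h1
    rintro _ ⟨z, hz, rfl⟩
    exact hU i z hz
  -- Minimality says `‖v‖² ≤ ⟪v, U i v⟫`; together with `‖U i v‖ = ‖v‖` this forces `‖U i v - v‖² ≤
  -- 0`.
  have h1 := (norm_eq_iInf_iff_real_inner_le_zero hconv hv).1 hmin _ hmem
  rw [zero_sub, inner_neg_left, inner_sub_right, real_inner_self_eq_norm_sq] at h1
  have h2 := norm_sub_sq_real (U i v) v
  rw [(U i).norm_map, real_inner_comm] at h2
  have h3 : ‖U i v - v‖ ^ 2 ≤ 0 := by linarith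
  exact sub_eq_zero.1 (norm_eq_zero.1 (pow_eq_zero_iff two_ne_zero |>.1
    (le_antisymm h3 (sq_nonneg _))))

/-- A version of the Lions–Lax–Milgram theorem. -/
theorem exists_forall_inner_eq_of_coercive {E : Type*} [AddCommGroup E] [Module ℝ E]
    (K : Submodule ℝ H) [CompleteSpace K] (J T : E →ₗ[ℝ] H) (F : E →ₗ[ℝ] ℝ) {a c : ℝ}
    (ha : 0 < a) (hc : 0 ≤ c)
    (hJK : ∀ g, J g ∈ K) (hcoer : ∀ g, a * ‖J g‖ ^ 2 ≤ |inner ℝ (J g) (T g)|)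
    (hF : ∀ g, |F g| ≤ c * ‖J g‖) :
    ∃ u ∈ K, ‖u‖ ≤ c / a ∧ ∀ g, inner ℝ u (T g) = F g := by
  -- Only the component of `T g` in `K` matters. Coercivity bounds `‖S g‖` below by `a * ‖J g‖`, so
  -- `F g` is a bounded functional of `S g`. Hahn–Banach extends it from the range of `S`, and Riesz
  -- represents it in `K`; `T` need not be bounded in terms of `J`.
  let S : E →ₗ[ℝ] K := K.orthogonalProjectionOnto.toLinearMap ∘ₗ T
  have hinner : ∀ (v : K) (g : E), inner ℝ v (S g) = inner ℝ (v : H) (T g) := fun v g => by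
    change inner ℝ v (K.orthogonalProjectionOnto (T g)) = _
    rw [K.inner_orthogonalProjectionOnto_eq_of_mem_left]
  have hbound : ∀ g, a * ‖J g‖ ≤ ‖S g‖ := fun g => by
    rcases (norm_nonneg (J g)).eq_or_lt with h0 | hpos
    · rw [← h0, mul_zero]; exact norm_nonneg _
    have h1 := (hcoer g).trans ((hinner ⟨J g, hJK g⟩ g) ▸ abs_real_inner_le_norm _ _)
    have h2 : ‖(⟨J g, hJK g⟩ : K)‖ = ‖J g‖ := rfl
    rw [h2] at h1
    exact le_of_mul_le_mul_left (by linarith [h1, sq (‖J g‖)] : ‖J g‖ * (a * ‖J g‖) ≤ _) hpos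
  have hFS : ∀ g, |F g| ≤ c / a * ‖S g‖ := fun g => (hF g).trans (by
    rw [div_mul_eq_mul_div, le_div_iff₀ ha, mul_assoc, mul_comm _ a]
    exact mul_le_mul_of_nonneg_left (hbound g) hc)
  have hker : LinearMap.ker S ≤ LinearMap.ker F := fun g hg => by
    have h := hFS g
    rw [LinearMap.mem_ker.1 hg, norm_zero, mul_zero] at h
    exact abs_nonpos_iff.1 h
  let f0 : LinearMap.range S →ₗ[ℝ] ℝ :=
    ((LinearMap.ker S).liftQ F hker) ∘ₗ S.quotKerEquivRange.symm.toLinearMap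
  have hf0 : ∀ g, f0 ⟨S g, LinearMap.mem_range_self S g⟩ = F g := fun g => by
    have h : S.quotKerEquivRange (Submodule.Quotient.mk g) =
      ⟨S g, LinearMap.mem_range_self S g⟩ := rfl
    change (LinearMap.ker S).liftQ F hker (S.quotKerEquivRange.symm _) = F g
    rw [← h, LinearEquiv.symm_apply_apply]
    rfl
  have hf0b : ∀ y, ‖f0 y‖ ≤ c / a * ‖y‖ := by
    rintro ⟨_, g, rfl⟩
    rw [hf0]; exact hFS g
  obtain ⟨f, hf, hfn⟩ := exists_extension_norm_eq _ (f0.mkContinuous _ hf0b)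
  refine ⟨((InnerProductSpace.toDual ℝ K).symm f : K), Subtype.coe_prop _, ?_, fun g => ?_⟩
  · have h : ‖(InnerProductSpace.toDual ℝ K).symm f‖ ≤ c / a := by
      rw [LinearIsometryEquiv.norm_map, hfn]
      exact LinearMap.mkContinuous_norm_le _ (div_nonneg hc ha.le) _
    exact h
  · rw [← hinner, InnerProductSpace.toDual_symm_apply]
    exact (hf ⟨S g, LinearMap.mem_range_self S g⟩).trans (hf0 g)

end Hilbert

/-! ### Truncation and its convex primitive. -/

/-- Truncation at height `M`. -/
noncomputable def trunc (M t : ℝ) : ℝ := max (-M) (min M t)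

/-- The primitive of `trunc M` which vanishes at `0`. -/
noncomputable def truncPrim (M t : ℝ) : ℝ := t * trunc M t - trunc M t ^ 2 / 2

theorem trunc_cases {M : ℝ} (hM : 0 ≤ M) (t : ℝ) :
    (t < -M ∧ trunc M t = -M) ∨ (|t| ≤ M ∧ trunc M t = t) ∨ (M < t ∧ trunc M t = M) := by
  unfold trunc
  rcases lt_or_ge t (-M) with h | h
  · left; exact ⟨h, max_eq_left ((min_le_right _ _).trans h.le)⟩
  rcases le_or_gt t M with h' | h'
  · right; left; exact ⟨abs_le.2 ⟨h, h'⟩, by rw [min_eq_right h', max_eq_right h]⟩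
  · right; right; exact ⟨h', by rw [min_eq_left h'.le, max_eq_right (by linarith)]⟩

theorem abs_trunc_le {M : ℝ} (hM : 0 ≤ M) (t : ℝ) : |trunc M t| ≤ M := by
  rcases trunc_cases hM t with ⟨_, h⟩ | ⟨h', h⟩ | ⟨_, h⟩ <;> rw [h]
  · rw [abs_neg, abs_of_nonneg hM]
  · exact h'
  · rw [abs_of_nonneg hM]

theorem continuous_trunc (M : ℝ) : Continuous (trunc M) := by
  unfold trunc; fun_prop

theorem continuous_truncPrim (M : ℝ) : Continuous (truncPrim M) := by
  have := continuous_trunc M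
  unfold truncPrim; fun_prop

/-- `truncPrim M t` is the maximum of `t * s - s ^ 2 / 2` over `|s| ≤ M`, attained at `s = trunc M
t`. Using the maximiser of `b` as a competitor at `a` gives this bound; using that of `a` at `b`
gives `truncPrim_bregman_nonneg`. -/
theorem truncPrim_sub_le {M : ℝ} (hM : 0 ≤ M) (a b : ℝ) :
    truncPrim M b - truncPrim M a ≤ M * |b - a| := by
  unfold truncPrim
  have hb := abs_trunc_le hM b
  rw [abs_le] at hb
  have h1 : b * trunc M b - trunc M b ^ 2 / 2 - (a * trunc M a - trunc M a ^ 2 / 2) ≤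
      (b - a) * trunc M b := by
    rcases trunc_cases hM a with ⟨ha, h⟩ | ⟨ha, h⟩ | ⟨ha, h⟩ <;> rw [h] <;>
      nlinarith [sq_nonneg (a - trunc M b)]
  refine h1.trans ((le_abs_self _).trans ?_)
  rw [abs_mul, mul_comm]
  exact mul_le_mul_of_nonneg_right (abs_le.2 hb) (abs_nonneg _)

theorem abs_truncPrim_sub_le {M : ℝ} (hM : 0 ≤ M) (a b : ℝ) :
    |truncPrim M b - truncPrim M a| ≤ M * |b - a| := by
  refine abs_le'.2 ⟨truncPrim_sub_le hM a b, ?_⟩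
  rw [neg_sub, abs_sub_comm]
  exact truncPrim_sub_le hM b a

theorem truncPrim_bregman_nonneg {M : ℝ} (hM : 0 ≤ M) (a b : ℝ) :
    0 ≤ truncPrim M b - truncPrim M a - (b - a) * trunc M a := by
  unfold truncPrim
  have hb := abs_le.1 (abs_trunc_le hM a)
  rcases trunc_cases hM b with ⟨ha, h⟩ | ⟨ha, h⟩ | ⟨ha, h⟩ <;> rw [h] <;>
    nlinarith [sq_nonneg (b - trunc M a)]

theorem truncPrim_bregman_eq {M : ℝ} {a b : ℝ} (ha : |a| ≤ M) (hb : |b| ≤ M) :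
    truncPrim M b - truncPrim M a - (b - a) * trunc M a = (b - a) ^ 2 / 2 := by
  unfold truncPrim trunc
  rw [abs_le] at ha hb
  rw [min_eq_right ha.2, max_eq_right ha.1, min_eq_right hb.2, max_eq_right hb.1]
  ring

instance (d : ℕ) : InvolutiveNeg (Step d) where
  neg_neg k := Subtype.ext (neg_neg k.1)

@[simp]
theorem coe_neg_step {d : ℕ} (k : Step d) : (-k).1 = -k.1 := rfl

/-! ### Square integrable families and bounded representatives. -/

section L2

variable {Ω : Type*} [MeasurableSpace Ω] {π : Measure Ω}

theorem integrable_mul_of_memLp_two {f g : Ω → ℝ} (hf : MemLp f 2 π) (hg : MemLp g 2 π) :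
    Integrable (fun ω => f ω * g ω) π :=
  hf.integrable_mul hg

theorem integral_abs_mul_le {f g : Ω → ℝ} (hf : MemLp f 2 π) (hg : MemLp g 2 π) :
    ∫ ω, |f ω * g ω| ∂π ≤ √(∫ ω, f ω ^ 2 ∂π) * √(∫ ω, g ω ^ 2 ∂π) := by
  have key : ∀ {f : Ω → ℝ} (hf : MemLp f 2 π), ‖hf.norm.toLp‖ = √(∫ ω, f ω ^ 2 ∂π) := by
    intro f hf
    rw [← Real.sqrt_sq (norm_nonneg _), ← real_inner_self_eq_norm_sq, L2.inner_def]
    congr 1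
    refine integral_congr_ae ?_
    filter_upwards [hf.norm.coeFn_toLp] with ω hω
    rw [hω]; simp [sq]
  rw [← key hf, ← key hg]
  refine le_trans (le_of_eq ?_) (real_inner_le_norm _ _)
  rw [L2.inner_def]
  refine integral_congr_ae ?_
  filter_upwards [hf.norm.coeFn_toLp, hg.norm.coeFn_toLp] with ω h1 h2
  rw [h1, h2]; simp [abs_mul, mul_comm]

variable {ι : Type*}

/-- The element of the Hilbert space of square integrable families given by a family of
functions. -/
noncomputable def toFields (u : ι → Ω → ℝ) (hu : ∀ k, MemLp (u k) 2 π) :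
    PiLp 2 fun _ : ι => Lp ℝ 2 π :=
  WithLp.toLp 2 fun k => (hu k).toLp

theorem toFields_coeFn (v : PiLp 2 fun _ : ι => Lp ℝ 2 π) :
    toFields (fun k => ⇑(v k)) (fun k => Lp.memLp (v k)) = v := by
  refine PiLp.ext fun k => ?_
  exact Lp.toLp_coeFn _ (Lp.memLp (v k))

theorem inner_toFields [Fintype ι] {u v : ι → Ω → ℝ} (hu : ∀ k, MemLp (u k) 2 π) (hv : ∀ k, MemLp (v k) 2 π) :
    inner ℝ (toFields u hu) (toFields v hv) = ∑ k, ∫ ω, u k ω * v k ω ∂π := by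
  rw [PiLp.inner_apply]
  refine Finset.sum_congr rfl fun k _ => ?_
  rw [L2.inner_def]
  refine integral_congr_ae ?_
  filter_upwards [(hu k).coeFn_toLp, (hv k).coeFn_toLp] with ω h1 h2
  change inner ℝ ((hu k).toLp (u k) ω) ((hv k).toLp (v k) ω) = _
  rw [h1, h2]
  simp [mul_comm]

theorem inner_toFields_right [Fintype ι] (u : PiLp 2 fun _ : ι => Lp ℝ 2 π) {v : ι → Ω → ℝ}
    (hv : ∀ k, MemLp (v k) 2 π) :
    inner ℝ u (toFields v hv) = ∑ k, ∫ ω, u k ω * v k ω ∂π := by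
  conv_lhs => rw [← toFields_coeFn u]
  exact inner_toFields _ hv

theorem norm_toFields_sq [Fintype ι] {u : ι → Ω → ℝ} (hu : ∀ k, MemLp (u k) 2 π) :
    ‖toFields u hu‖ ^ 2 = ∑ k, ∫ ω, u k ω ^ 2 ∂π := by
  rw [← real_inner_self_eq_norm_sq, inner_toFields]
  simp only [sq]

theorem toFields_sub {u v : ι → Ω → ℝ} (hu : ∀ k, MemLp (u k) 2 π) (hv : ∀ k, MemLp (v k) 2 π) :
    toFields u hu - toFields v hv = toFields (u - v) fun k => (hu k).sub (hv k) := rfl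

theorem toFields_add {u v : ι → Ω → ℝ} (hu : ∀ k, MemLp (u k) 2 π) (hv : ∀ k, MemLp (v k) 2 π) :
    toFields u hu + toFields v hv = toFields (u + v) fun k => (hu k).add (hv k) := rfl

theorem smul_toFields (c : ℝ) {u : ι → Ω → ℝ} (hu : ∀ k, MemLp (u k) 2 π) :
    c • toFields u hu = toFields (c • u) fun k => (hu k).const_smul c := rfl

theorem toFields_congr {u v : ι → Ω → ℝ} (hu : ∀ k, MemLp (u k) 2 π) (hv : ∀ k, MemLp (v k) 2 π)
    (h : ∀ k, u k =ᵐ[π] v k) : toFields u hu = toFields v hv := by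
  refine PiLp.ext fun k => ?_
  exact (MemLp.toLp_eq_toLp_iff (hu k) (hv k)).2 (h k)

/-- Bounded measurable functions. -/
structure IsBddMeas (g : Ω → ℝ) : Prop where
  measurable : Measurable g
  bound : ∃ C : ℝ, ∀ ω, |g ω| ≤ C

variable (Ω) in
/-- The space of bounded measurable functions. -/
def boundedMeasurable : Submodule ℝ (Ω → ℝ) where
  carrier := {g | IsBddMeas g}
  add_mem' := by
    rintro f g ⟨hf, C, hC⟩ ⟨hg, D, hD⟩
    exact ⟨hf.add hg, C + D, fun ω => (abs_add_le _ _).trans (add_le_add (hC ω) (hD ω))⟩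
  zero_mem' := ⟨measurable_const, 0, fun _ => by simp⟩
  smul_mem' := by
    rintro c f ⟨hf, C, hC⟩
    refine ⟨hf.const_smul c, |c| * C, fun ω => ?_⟩
    rw [Pi.smul_apply, smul_eq_mul, abs_mul]
    exact mul_le_mul_of_nonneg_left (hC ω) (abs_nonneg c)

/-- Representatives bounded at every point keep their bounds under translation and composition
without exceptional sets. -/
theorem exists_isBddMeas_ae_eq {f : Ω → ℝ} (hf : MemLp f ∞ π) :
    ∃ g, IsBddMeas g ∧ f =ᵐ[π] g := by
  obtain ⟨g, hg, hfg⟩ := hf.1.aemeasurable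
  have hb : ∃ C : ℝ, 0 ≤ C ∧ ∀ᵐ ω ∂π, |f ω| ≤ C :=
    ⟨(eLpNormEssSup f π).toReal, ENNReal.toReal_nonneg, by
      have h2 : eLpNormEssSup f π ≠ ∞ := by
        have := hf.2.ne
        rwa [eLpNorm_exponent_top] at this
      filter_upwards [enorm_ae_le_eLpNormEssSup f π] with ω hω
      have := ENNReal.toReal_mono h2 hω
      rwa [toReal_enorm, Real.norm_eq_abs] at this⟩
  obtain ⟨C, hC0, hC⟩ := hb
  refine ⟨fun ω => trunc C (g ω), ⟨(continuous_trunc C).measurable.comp hg, C,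
    fun ω => abs_trunc_le hC0 _⟩, ?_⟩
  filter_upwards [hfg, hC] with ω h1 h2
  rw [h1] at h2 ⊢
  rcases trunc_cases hC0 (g ω) with ⟨h, _⟩ | ⟨_, h⟩ | ⟨h, _⟩
  · linarith [(abs_le.1 h2).1]
  · exact h.symm
  · linarith [(abs_le.1 h2).2]

end L2

theorem IsBddMeas.vadd {G Ω : Type*} [MeasurableSpace Ω] [VAdd G Ω]
    [MeasurableConstVAdd G Ω] {f : Ω → ℝ} (hf : IsBddMeas f)
    (x : G) : IsBddMeas fun ω => f (x +ᵥ ω) := by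
  obtain ⟨hm, C, hC⟩ := hf
  exact ⟨hm.comp (measurable_const_vadd x), C, fun ω => hC _⟩

theorem IsBddMeas.mul {Ω : Type*} [MeasurableSpace Ω] {f g : Ω → ℝ}
    (hf : IsBddMeas f) (hg : IsBddMeas g) :
    IsBddMeas fun ω => f ω * g ω := by
  obtain ⟨hm, C, hC⟩ := hf
  obtain ⟨hm', D, hD⟩ := hg
  refine ⟨hm.mul hm', C * D, fun ω => ?_⟩
  rw [abs_mul]
  exact mul_le_mul (hC ω) (hD ω) (abs_nonneg _) ((abs_nonneg _).trans (hC ω))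

theorem IsBddMeas.memLp {Ω : Type*} [MeasurableSpace Ω] {π : Measure Ω} [IsFiniteMeasure π]
    {g : Ω → ℝ} (hg : IsBddMeas g) (q : ℝ≥0∞) : MemLp g q π := by
  obtain ⟨hm, C, hC⟩ := hg
  exact MemLp.of_bound hm.aestronglyMeasurable C (Filter.Eventually.of_forall fun ω => by
    simpa using hC ω)

theorem IsBddMeas.memLp_mul {Ω : Type*} [MeasurableSpace Ω] {π : Measure Ω}
    {f g : Ω → ℝ} {q : ℝ≥0∞} (hg : IsBddMeas g) (hf : MemLp f q π) :
    MemLp (fun ω => f ω * g ω) q π := by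
  obtain ⟨hm, C, hC⟩ := hg
  refine (hf.const_mul C).mono (hf.1.mul hm.aestronglyMeasurable)
    (Filter.Eventually.of_forall fun ω => ?_)
  simp only [norm_mul, Real.norm_eq_abs]
  rw [mul_comm]
  exact mul_le_mul_of_nonneg_right ((hC ω).trans (le_abs_self C)) (abs_nonneg _)

theorem IsBddMeas.integrable_mul {Ω : Type*} [MeasurableSpace Ω] {π : Measure Ω}
    {f g : Ω → ℝ} (hg : IsBddMeas g) (hf : Integrable f π) :
    Integrable (fun ω => f ω * g ω) π :=
  memLp_one_iff_integrable.1 (hg.memLp_mul (memLp_one_iff_integrable.2 hf))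

theorem IsBddMeas.grad {d : ℕ} {Ω : Type*} [MeasurableSpace Ω] [AddAction (Fin d → ℤ) Ω]
    [MeasurableConstVAdd (Fin d → ℤ) Ω] {g : Ω → ℝ} (hg : IsBddMeas g) (k : Step d) :
    IsBddMeas (RWRE.grad g k) :=
  Submodule.sub_mem (boundedMeasurable Ω) (hg.vadd k.1) hg

/-! ### Convex hulls of orbits under an ergodic action. -/

section Ergodic

variable {G Ω : Type*} [MeasurableSpace Ω] [AddGroup G] [AddAction G Ω] [MeasurableConstVAdd G Ω]
  {π : Measure Ω} [ErgodicVAdd G Ω π]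

/-- The Koopman isometries on square integrable families. -/
noncomputable def koopman {ι : Type*} [Fintype ι] (π : Measure Ω) [ErgodicVAdd G Ω π] (x : G) :
    (PiLp 2 fun _ : ι => Lp ℝ 2 π) →ₗᵢ[ℝ] PiLp 2 fun _ : ι => Lp ℝ 2 π where
  toFun v := WithLp.toLp 2 fun k =>
    Lp.compMeasurePreservingₗᵢ ℝ (x +ᵥ ·) (measurePreserving_vadd x π) (v k)
  map_add' u v := by
    refine PiLp.ext fun k => ?_
    simp
  map_smul' c v := by
    refine PiLp.ext fun k => ?_
    simp
  norm_map' v := by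
    rw [← sq_eq_sq₀ (norm_nonneg _) (norm_nonneg _)]
    change ‖(WithLp.toLp 2 _ : PiLp 2 fun _ : ι => Lp ℝ 2 π)‖ ^ 2 = _
    rw [PiLp.norm_sq_eq_of_L2, PiLp.norm_sq_eq_of_L2]
    refine Finset.sum_congr rfl fun k _ => ?_
    change ‖Lp.compMeasurePreservingₗᵢ ℝ (x +ᵥ ·) (measurePreserving_vadd x π) (v k)‖ ^ 2 = _
    rw [LinearIsometry.norm_map]

theorem koopman_coeFn {ι : Type*} [Fintype ι] (x : G) (v : PiLp 2 fun _ : ι => Lp ℝ 2 π) (k : ι) :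
    koopman π x v k =ᵐ[π] fun ω => v k (x +ᵥ ω) :=
  Lp.coeFn_compMeasurePreserving (v k) (measurePreserving_vadd x π)

theorem koopman_toFields {ι : Type*} [Fintype ι] (x : G) {u : ι → Ω → ℝ}
    (hu : ∀ k, MemLp (u k) 2 π) :
    koopman π x (toFields u hu) = toFields (fun k ω => u k (x +ᵥ ω))
      (fun k => (hu k).comp_measurePreserving (measurePreserving_vadd x π)) := rfl

/-- A consequence of the mean ergodic theorem: square integrable version. -/
theorem zero_mem_closure_convexHull_orbit [IsProbabilityMeasure π] {ι : Type*} [Fintype ι]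
    {u : ι → Ω → ℝ} (hu : ∀ k, MemLp (u k) 2 π) (hu0 : ∀ k, ∫ ω, u k ω ∂π = 0) :
    (0 : PiLp 2 fun _ : ι => Lp ℝ 2 π) ∈
      closure (convexHull ℝ (Set.range fun x : G => koopman π x (toFields u hu))) := by
  obtain ⟨v, hv, hfix⟩ := exists_fixed_mem_closure_convexHull (fun x : G => koopman π x)
    (S := Set.range fun x : G => koopman π x (toFields u hu)) ⟨_, 0, rfl⟩ (by
      rintro x _ ⟨y, rfl⟩
      refine ⟨y + x, ?_⟩
      simp only [koopman_toFields]
      congr 1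
      funext k ω
      rw [add_vadd])
  -- The invariant vector `v` has almost surely constant components by ergodicity. Zero mean is a
  -- closed linear condition satisfied on the whole orbit, so these constants vanish.
  suffices v = 0 by rwa [this] at hv
  have hone : ∀ k : ι, MemLp (fun _ : Ω => (1 : ℝ)) 2 π := fun k => memLp_const 1
  have hmean : ∀ k, ∫ ω, v k ω ∂π = 0 := by
    intro k
    have hL : ∀ y : PiLp 2 fun _ : ι => Lp ℝ 2 π,
        inner ℝ (y k) ((hone k).toLp _) = ∫ ω, y k ω ∂π := by
      intro y
      rw [L2.inner_def]
      refine integral_congr_ae ?_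
      filter_upwards [(hone k).coeFn_toLp] with ω hω
      rw [hω]; simp
    let Z : Submodule ℝ (PiLp 2 fun _ : ι => Lp ℝ 2 π) :=
      LinearMap.ker ((innerₛₗ ℝ ((hone k).toLp (fun _ : Ω => (1 : ℝ)))).comp
        (PiLp.projₗ 2 (𝕜 := ℝ) (fun _ : ι => Lp ℝ 2 π) k))
    have hZ : ∀ y, y ∈ Z ↔ ∫ ω, y k ω ∂π = 0 := fun y => by
      rw [← hL, real_inner_comm]; exact Iff.rfl
    have hZc : IsClosed (Z : Set (PiLp 2 fun _ : ι => Lp ℝ 2 π)) := by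
      have : (Z : Set (PiLp 2 fun _ : ι => Lp ℝ 2 π)) =
          {y | inner ℝ (y k) ((hone k).toLp (fun _ : Ω => (1 : ℝ))) = 0} := by
        ext y; rw [Set.mem_ofPred_eq, hL]; exact hZ y
      rw [this]
      exact isClosed_eq (by fun_prop) continuous_const
    have hsub : closure (convexHull ℝ (Set.range fun x : G => koopman π x (toFields u hu))) ⊆ Z := by
      refine closure_minimal (convexHull_min ?_ Z.convex) hZc
      rintro _ ⟨x, rfl⟩
      refine (hZ _).2 ?_
      beta_reduce
      rw [← hu0 k]
      refine (integral_congr_ae (MemLp.coeFn_toLp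
        ((hu k).comp_measurePreserving (measurePreserving_vadd x π)))).trans ?_
      exact integral_vadd_eq_self (μ := π) (u k) (g := x)
    exact (hZ v).1 (hsub hv)
  refine PiLp.ext fun k => ?_
  refine Lp.ext ?_
  obtain ⟨c, hc⟩ := ae_eq_const_of_forall_vadd_ae_eq G (f := v k)
    (Lp.aestronglyMeasurable (v k)).aemeasurable fun x => by
      have := koopman_coeFn x v k
      rw [hfix x] at this
      exact this.symm
  have h0 := hmean k
  rw [integral_congr_ae hc] at h0
  simp only [integral_const, probReal_univ, one_smul] at h0
  filter_upwards [hc, Lp.coeFn_zero ℝ 2 π] with ω h1 h2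
  change v k ω = (0 : Lp ℝ 2 π) ω
  rw [h1, h2, h0]; rfl

theorem exists_isBddMeas_integral_abs_sub_le {Ω : Type*} [MeasurableSpace Ω] {π : Measure Ω}
    {a : Ω → ℝ} (ha : Integrable a π) {ε : ℝ} (hε : 0 < ε) :
    ∃ b : Ω → ℝ, IsBddMeas b ∧ Integrable b π ∧ ∫ ω, |a ω - b ω| ∂π ≤ ε := by
  obtain ⟨b, hb, hbL⟩ := (memLp_one_iff_integrable.2 ha).exists_simpleFunc_eLpNorm_sub_lt
    ENNReal.one_ne_top (ε := ENNReal.ofReal ε) (by simpa using hε)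
  have hbi := memLp_one_iff_integrable.1 hbL
  refine ⟨b, ⟨b.measurable, ?_⟩, hbi, ?_⟩
  · obtain ⟨C, hC⟩ := b.exists_forall_norm_le
    exact ⟨C, hC⟩
  · rw [eLpNorm_one_eq_lintegral_enorm] at hb
    rw [← ENNReal.ofReal_le_ofReal_iff hε.le]
    refine le_trans (le_of_eq ?_) hb.le
    exact ofReal_integral_norm_eq_lintegral_enorm (ha.sub hbi)

/-- If `u` is a bounded centred family and the pairing of the integrable family `a` with the
translates of `u` is constant, then it vanishes. -/
theorem sum_integral_mul_eq_zero_of_forall_vadd_eq [IsProbabilityMeasure π] {ι : Type*} [Fintype ι]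
    {a u : ι → Ω → ℝ} (ha : ∀ k, Integrable (a k) π) (hu : ∀ k, IsBddMeas (u k))
    (hu0 : ∀ k, ∫ ω, u k ω ∂π = 0) {c : ℝ}
    (hc : ∀ x : G, ∑ k, ∫ ω, a k ω * u k (x +ᵥ ω) ∂π = c) : c = 0 := by
  have hu2 : ∀ k, MemLp (u k) 2 π := fun k => (hu k).memLp 2
  choose C hC using fun k => (hu k).bound
  have key : ∀ ε > 0, |c| ≤ (∑ k, |C k|) * ε := by
    intro ε hε
    -- An integrable `a` need not pair continuously with the `L²` closure of the hull. A bounded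
    -- `L¹`-approximation `b` does, and the sup bounds of `u` control the error uniformly along the
    -- orbit.
    choose b hb hbi hab using fun k => exists_isBddMeas_integral_abs_sub_le (ha k) hε
    have hb2 : ∀ k, MemLp (b k) 2 π := fun k => (hb k).memLp 2
    have hsub : closure (convexHull ℝ (Set.range fun x : G => koopman π x (toFields u hu2))) ⊆
        {y | |inner ℝ (toFields b hb2) y - c| ≤ (∑ k, |C k|) * ε} := by
      refine closure_minimal (convexHull_min ?_ ?_) ?_
      · rintro _ ⟨x, rfl⟩
        beta_reduce
        rw [Set.mem_ofPred_eq, koopman_toFields, inner_toFields, ← hc x, ← Finset.sum_sub_distrib,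
          Finset.sum_mul]
        refine (Finset.abs_sum_le_sum_abs _ _).trans (Finset.sum_le_sum fun k _ => ?_)
        rw [← integral_sub (((hu k).vadd x).integrable_mul (hbi k))
          (((hu k).vadd x).integrable_mul (ha k))]
        refine (abs_integral_le_integral_abs).trans ?_
        calc ∫ ω, |b k ω * u k (x +ᵥ ω) - a k ω * u k (x +ᵥ ω)| ∂π
            ≤ ∫ ω, |C k| * |a k ω - b k ω| ∂π := by
              refine integral_mono_of_nonneg (Filter.Eventually.of_forall fun _ => abs_nonneg _)
                (((ha k).sub (hbi k)).abs.const_mul _) (Filter.Eventually.of_forall fun ω => ?_)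
              change |b k ω * u k (x +ᵥ ω) - a k ω * u k (x +ᵥ ω)| ≤ _
              rw [← sub_mul, abs_mul, abs_sub_comm, mul_comm]
              exact mul_le_mul_of_nonneg_right ((hC k _).trans (le_abs_self _)) (abs_nonneg _)
          _ ≤ |C k| * ε := by
              rw [integral_const_mul]
              exact mul_le_mul_of_nonneg_left (hab k) (abs_nonneg _)
      · have : {y : PiLp 2 fun _ : ι => Lp ℝ 2 π |
            |inner ℝ (toFields b hb2) y - c| ≤ (∑ k, |C k|) * ε} =
            (innerₛₗ ℝ (toFields b hb2)) ⁻¹' Metric.closedBall c ((∑ k, |C k|) * ε) := by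
          ext y; simp [Real.dist_eq]
        rw [this]
        exact (convex_closedBall _ _).linear_preimage _
      · exact isClosed_le (by fun_prop) continuous_const
    have := hsub (zero_mem_closure_convexHull_orbit (G := G) hu2 hu0)
    simpa using this
  by_contra hne
  have hpos : 0 < |c| := abs_pos.2 hne
  have hS : 0 ≤ ∑ k, |C k| := Finset.sum_nonneg fun _ _ => abs_nonneg _
  have := key (|c| / (2 * (∑ k, |C k| + 1))) (by positivity)
  have h2 : (∑ k, |C k|) * (|c| / (2 * (∑ k, |C k| + 1))) ≤ |c| / 2 := by
    rw [mul_div_assoc', div_le_div_iff₀ (by positivity) two_pos]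
    nlinarith
  linarith

end Ergodic
-- Lattice paths and bond reversal.
section Lattice

variable {d : ℕ}

theorem exists_step_add {x : Fin d → ℤ} {n : ℕ} (hx : ∑ i, |x i| = n + 1) :
    ∃ (l : Step d) (y : Fin d → ℤ), x = l.1 + y ∧ ∑ i, |y i| = n := by
  obtain ⟨i, hi⟩ : ∃ i, x i ≠ 0 := by
    by_contra! h
    simp [h] at hx
    omega
  have hupd : ∀ (f : Fin d → ℤ) (a : ℤ),
      ∑ j, |Function.update f i a j| = |a| + ∑ j ∈ Finset.univ.erase i, |f j| := by
    intro f a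
    rw [← Finset.add_sum_erase _ _ (Finset.mem_univ i), Function.update_self]
    congr 1
    refine Finset.sum_congr rfl fun j hj => ?_
    rw [Function.update_of_ne (Finset.ne_of_mem_erase hj)]
  have hx' := Finset.add_sum_erase Finset.univ (fun j => |x j|) (Finset.mem_univ i)
  refine ⟨⟨Function.update 0 i (x i).sign, (mem_steps _).2 ?_⟩,
    Function.update x i (x i - (x i).sign), ?_, ?_⟩
  · rw [hupd]
    rcases lt_or_gt_of_ne hi with h | h
    · simp [Int.sign_eq_neg_one_of_neg h]
    · simp [Int.sign_eq_one_of_pos h]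
  · funext j
    by_cases hj : j = i
    · subst hj; simp
    · simp [hj]
  · rw [hupd]
    rcases lt_or_gt_of_ne hi with h | h
    · rw [Int.sign_eq_neg_one_of_neg h, abs_of_nonpos (by omega)]
      rw [abs_of_neg h] at hx'
      omega
    · rw [Int.sign_eq_one_of_pos h, abs_of_nonneg (by omega)]
      rw [abs_of_pos h] at hx'
      omega

/-- The natural number counts the steps of a shortest path from the origin, which later yields
bounds linear in the `ℓ¹` distance. -/
theorem lattice_induction {P : (Fin d → ℤ) → ℕ → Prop} (h0 : P 0 0)
    (hstep : ∀ (l : Step d) x n, P x n → P (l.1 + x) (n + 1)) (x : Fin d → ℤ) :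
    P x (∑ i, |x i|).toNat := by
  have key : ∀ n : ℕ, ∀ x : Fin d → ℤ, ∑ i, |x i| = n → P x n := by
    intro n
    induction n with
    | zero =>
      intro x hx
      have : x = 0 := by
        funext i
        have := (Finset.sum_eq_zero_iff_of_nonneg fun i _ => abs_nonneg (x i)).1 hx i
          (Finset.mem_univ i)
        exact abs_eq_zero.1 this
      rwa [this]
    | succ n ih =>
      intro x hx
      obtain ⟨l, y, rfl, hy⟩ := exists_step_add (by exact_mod_cast hx)
      exact hstep l y n (ih y hy)
  exact key _ x (Int.toNat_of_nonneg (Finset.sum_nonneg fun i _ => abs_nonneg (x i))).symm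

end Lattice

section Shift

variable {d : ℕ} {Ω : Type*} [MeasurableSpace Ω] [AddAction (Fin d → ℤ) Ω]
  [MeasurableConstVAdd (Fin d → ℤ) Ω] {μ : Measure Ω} [VAddInvariantMeasure (Fin d → ℤ) Ω μ]

theorem integral_vadd (f : Ω → ℝ) (x : Fin d → ℤ) : ∫ ω, f (x +ᵥ ω) ∂μ = ∫ ω, f ω ∂μ :=
  integral_vadd_eq_self f

theorem ae_vadd {P : Ω → Prop} (h : ∀ᵐ ω ∂μ, P ω) (x : Fin d → ℤ) : ∀ᵐ ω ∂μ, P (x +ᵥ ω) :=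
  (measurePreserving_vadd x μ).quasiMeasurePreserving.ae h

theorem integrable_vadd {f : Ω → ℝ} (hf : Integrable f μ) (x : Fin d → ℤ) :
    Integrable (fun ω => f (x +ᵥ ω)) μ :=
  (measurePreserving_vadd x μ).integrable_comp_of_integrable hf

/-- This is summation by parts: each bond is read from its other end point, which invariance of the
measure allows. -/
theorem sum_integral_flip (f : Step d → Ω → ℝ) :
    ∑ k : Step d, ∫ ω, f (-k) (k.1 +ᵥ ω) ∂μ = ∑ k, ∫ ω, f k ω ∂μ := by
  simp only [integral_vadd (μ := μ)]
  exact Equiv.sum_comp (Equiv.neg (Step d)) fun k => ∫ ω, f k ω ∂μ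

omit [MeasurableSpace Ω] [MeasurableConstVAdd (Fin d → ℤ) Ω] in
@[simp]
theorem neg_step_vadd_step_vadd (k : Step d) (ω : Ω) : (-k.1) +ᵥ (k.1 +ᵥ ω) = ω :=
  neg_vadd_vadd _ _

end Shift

theorem measurable_grad {d : ℕ} {Ω : Type*} [MeasurableSpace Ω] [AddAction (Fin d → ℤ) Ω]
    [MeasurableConstVAdd (Fin d → ℤ) Ω] {g : Ω → ℝ} (hg : Measurable g) (k : Step d) :
    Measurable (grad g k) :=
  (hg.comp (measurable_const_vadd k.1)).sub hg

theorem grad_neg_vadd {d : ℕ} {Ω : Type*} [AddAction (Fin d → ℤ) Ω]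
    (g : Ω → ℝ) (k : Step d) (ω : Ω) : grad g (-k) (k.1 +ᵥ ω) = -grad g k ω := by
  simp [grad]

theorem isGradientField_grad {d : ℕ} {Ω : Type*} [MeasurableSpace Ω] [AddAction (Fin d → ℤ) Ω]
    [MeasurableConstVAdd (Fin d → ℤ) Ω] (μ : Measure Ω) {g : Ω → ℝ} (hg : Measurable g) :
    IsGradientField μ (grad (d := d) g) := by
  refine ⟨⟨fun k => (measurable_grad hg k).aemeasurable, fun k => ?_⟩, fun k l => ?_⟩
  · exact Filter.Eventually.of_forall fun ω => by rw [grad_neg_vadd]; ring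
  · refine Filter.Eventually.of_forall fun ω => ?_
    simp only [grad]
    rw [vadd_comm l.1 k.1 ω]
    ring

/-! ### The Dirichlet form and the closure of gradients. -/

namespace Environment

variable {d : ℕ} {Ω : Type*} [MeasurableSpace Ω] [AddAction (Fin d → ℤ) Ω] {π : Measure Ω}
  (E : Environment d Ω π)

theorem s_nonneg (k : Step d) (ω : Ω) : 0 ≤ E.s k ω :=
  div_nonneg (add_nonneg (E.p_nonneg _ _) (E.p_nonneg _ _)) two_pos.le

theorem r_sq (k : Step d) (ω : Ω) : E.r k ω ^ 2 = E.s k ω := Real.sq_sqrt (E.s_nonneg k ω)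

theorem r_pos (k : Step d) : ∀ᵐ ω ∂π, 0 < E.r k ω :=
  (E.weakly_elliptic k).mono fun _ h => Real.sqrt_pos.2 h

theorem p_le (k : Step d) (ω : Ω) : E.p k ω ≤ 2 * E.s k ω := by
  have := E.p_nonneg (-k) (k.1 +ᵥ ω)
  simp only [s]; linarith

theorem s_neg_vadd (k : Step d) (ω : Ω) : E.s (-k) (k.1 +ᵥ ω) = E.s k ω := by
  simp [s, add_comm]

theorem r_neg_vadd (k : Step d) (ω : Ω) : E.r (-k) (k.1 +ᵥ ω) = E.r k ω := by
  simp only [r, s_neg_vadd]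

theorem integrable_s (hr : ∀ k, MemLp (E.r k) 2 π) (k : Step d) : Integrable (E.s k) π := by
  have := (hr k).integrable_sq
  simpa only [r_sq] using this

theorem integrable_p (hr : ∀ k, MemLp (E.r k) 2 π) (k : Step d) : Integrable (E.p k) π :=
  ((E.integrable_s hr k).const_mul 2).mono' (E.measurable_p k).aestronglyMeasurable
    (Filter.Eventually.of_forall fun ω => by
      rw [Real.norm_of_nonneg (E.p_nonneg k ω)]; exact E.p_le k ω)

variable [MeasurableConstVAdd (Fin d → ℤ) Ω]

theorem measurable_s (k : Step d) : Measurable (E.s k) :=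
  ((E.measurable_p k).add ((E.measurable_p (-k)).comp (measurable_const_vadd k.1))).div_const 2

theorem measurable_r (k : Step d) : Measurable (E.r k) :=
  Real.continuous_sqrt.measurable.comp (E.measurable_s k)

theorem memLp_p_div_r (hr : ∀ k, MemLp (E.r k) 2 π) (k : Step d) :
    MemLp (fun ω => E.p k ω / E.r k ω) 2 π := by
  refine ((hr k).const_mul 2).mono ((E.measurable_p k).div (E.measurable_r k)).aestronglyMeasurable
    ((E.r_pos k).mono fun ω h => ?_)
  rw [Real.norm_of_nonneg (div_nonneg (E.p_nonneg k ω) h.le), Real.norm_of_nonneg (by positivity),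
    div_le_iff₀ h]
  have := E.p_le k ω
  rw [← E.r_sq] at this
  linarith

theorem memLp_mulR_grad (hr : ∀ k, MemLp (E.r k) 2 π) {g : Ω → ℝ} (hg : IsBddMeas g) (k : Step d) :
    MemLp (E.mulR (grad g) k) 2 π :=
  (hg.grad k).memLp_mul (hr k)

section Invariant

variable [VAddInvariantMeasure (Fin d → ℤ) Ω π]

/-- Bistochasticity: the measure is invariant for the environment process. -/
theorem sum_integral_p_mul_grad (hp : ∀ k, Integrable (E.p k) π) {F : Ω → ℝ} (hF : IsBddMeas F) :
    ∑ k, ∫ ω, E.p k ω * grad F k ω ∂π = 0 := by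
  have h1 : ∀ k : Step d, Integrable (fun ω => E.p k ω * F (k.1 +ᵥ ω)) π := fun k =>
    (hF.vadd k.1).integrable_mul (hp k)
  have h2 : ∀ k : Step d, Integrable (fun ω => E.p k ω * F ω) π := fun k =>
    hF.integrable_mul (hp k)
  have h3 : ∀ k : Step d, Integrable (fun ω => E.p (-k) (k.1 +ᵥ ω) * F ω) π := fun k =>
    hF.integrable_mul (integrable_vadd (hp (-k)) k.1)
  simp only [grad, mul_sub]
  simp_rw [integral_sub (h1 _) (h2 _)]
  rw [Finset.sum_sub_distrib, ← sum_integral_flip (μ := π) fun k ω => E.p k ω * F (k.1 +ᵥ ω)]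
  simp only [coe_neg_step, neg_step_vadd_step_vadd]
  rw [← integral_finsetSum _ fun k _ => h3 k, ← integral_finsetSum _ fun k _ => h2 k, sub_eq_zero]
  refine integral_congr_ae (E.bistochastic.mono fun ω h => ?_)
  change ∑ k : Step d, E.p (-k) (k.1 +ᵥ ω) * F ω = ∑ k, E.p k ω * F ω
  rw [← Finset.sum_mul, ← Finset.sum_mul, h]

/-- Bond reversal exchanges `p_k` with `p_{-k} ∘ τ_k`, so a weight independent of the orientation
sees only their mean `s_k`. -/
theorem sum_integral_p_mul_even (hp : ∀ k, Integrable (E.p k) π) {a : Step d → Ω → ℝ}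
    (ha : ∀ k, IsBddMeas (a k)) (hae : ∀ k ω, a (-k) (k.1 +ᵥ ω) = a k ω) :
    ∑ k, ∫ ω, E.p k ω * a k ω ∂π = ∑ k, ∫ ω, E.s k ω * a k ω ∂π := by
  have h1 : ∀ k : Step d, Integrable (fun ω => E.p k ω * a k ω) π := fun k =>
    (ha k).integrable_mul (hp k)
  have h3 : ∀ k : Step d, Integrable (fun ω => E.p (-k) (k.1 +ᵥ ω) * a k ω) π := fun k =>
    (ha k).integrable_mul (integrable_vadd (hp (-k)) k.1)
  have h4 : ∀ k, ∫ ω, E.s k ω * a k ω ∂π =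
      (1 / 2) * ∫ ω, E.p k ω * a k ω ∂π + (1 / 2) * ∫ ω, E.p (-k) (k.1 +ᵥ ω) * a k ω ∂π := by
    intro k
    rw [← mul_add, ← integral_add (h1 k) (h3 k), ← integral_const_mul]
    congr 1; funext ω; simp only [s]; ring
  simp_rw [h4]
  rw [Finset.sum_add_distrib, ← Finset.mul_sum, ← Finset.mul_sum]
  have h5 := sum_integral_flip (μ := π) fun k ω => E.p k ω * a k ω
  simp only [hae] at h5
  rw [h5]; ring

/-- The Dirichlet form of the generator. -/
theorem sum_integral_p_mul_grad_mul_self (hp : ∀ k, Integrable (E.p k) π) {g : Ω → ℝ}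
    (hg : IsBddMeas g) :
    ∑ k, ∫ ω, E.p k ω * (grad g k ω * g ω) ∂π =
      -(1 / 2) * ∑ k, ∫ ω, E.s k ω * grad g k ω ^ 2 ∂π := by
  have hsq : ∀ k : Step d, IsBddMeas fun ω => grad g k ω ^ 2 := fun k => by
    simpa only [sq] using (hg.grad k).mul (hg.grad k)
  rw [← E.sum_integral_p_mul_even hp hsq fun k ω => by rw [grad_neg_vadd, neg_sq]]
  have h0 := E.sum_integral_p_mul_grad hp (hg.mul hg)
  have hi : ∀ k : Step d, Integrable (fun ω => E.p k ω * grad (fun ω => g ω * g ω) k ω) π :=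
    fun k => ((hg.mul hg).grad k).integrable_mul (hp k)
  have hi2 : ∀ k : Step d, Integrable (fun ω => E.p k ω * grad g k ω ^ 2) π :=
    fun k => (hsq k).integrable_mul (hp k)
  -- The identity is `g ∇g = ½ ∇(g²) - ½ (∇g)²`; the first term sums to zero by bistochasticity.
  have h4 : ∀ k, ∫ ω, E.p k ω * (grad g k ω * g ω) ∂π =
      (1 / 2) * ∫ ω, E.p k ω * grad (fun ω => g ω * g ω) k ω ∂π
        - (1 / 2) * ∫ ω, E.p k ω * grad g k ω ^ 2 ∂π := by
    intro k
    rw [← mul_sub, ← integral_sub (hi k) (hi2 k), ← integral_const_mul]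
    congr 1; funext ω; simp only [grad]; ring
  simp_rw [h4]
  rw [Finset.sum_sub_distrib, ← Finset.mul_sum, ← Finset.mul_sum, h0]
  ring

end Invariant

/-- The map `g ↦ R ∇ g` from bounded measurable functions to the Hilbert space of square integrable
families. -/
noncomputable def gradMap (hr : ∀ k, MemLp (E.r k) 2 π) :
    boundedMeasurable Ω →ₗ[ℝ] PiLp 2 fun _ : Step d => Lp ℝ 2 π where
  toFun g := toFields (E.mulR (grad g.1)) (E.memLp_mulR_grad hr g.2)
  map_add' f g := by
    rw [toFields_add]
    congr 1
    funext k ω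
    simp only [mulR, grad, Pi.add_apply, Submodule.coe_add]
    ring
  map_smul' c g := by
    rw [RingHom.id_apply, smul_toFields]
    congr 1
    funext k ω
    simp only [mulR, grad, Pi.smul_apply, Submodule.coe_smul, smul_eq_mul]
    ring

/-- The map `g ↦ (g p_k / r_k)_k`. -/
noncomputable def driftMap (hr : ∀ k, MemLp (E.r k) 2 π) :
    boundedMeasurable Ω →ₗ[ℝ] PiLp 2 fun _ : Step d => Lp ℝ 2 π where
  toFun g := toFields (fun k ω => E.p k ω / E.r k ω * g.1 ω) fun k =>
    IsBddMeas.memLp_mul (f := fun ω => E.p k ω / E.r k ω) g.2 (E.memLp_p_div_r hr k)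
  map_add' f g := by
    rw [toFields_add]
    congr 1
    funext k ω
    simp only [Pi.add_apply, Submodule.coe_add]
    ring
  map_smul' c g := by
    rw [RingHom.id_apply, smul_toFields]
    congr 1
    funext k ω
    simp only [Pi.smul_apply, Submodule.coe_smul, smul_eq_mul]
    ring

/-- The closure of the fields `R ∇ g`, `g` bounded and measurable. -/
noncomputable def gradClosure (hr : ∀ k, MemLp (E.r k) 2 π) :
    Submodule ℝ (PiLp 2 fun _ : Step d => Lp ℝ 2 π) :=
  (LinearMap.range (E.gradMap hr)).topologicalClosure

theorem gradMap_mem_gradClosure (hr : ∀ k, MemLp (E.r k) 2 π) (g : boundedMeasurable Ω) :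
    E.gradMap hr g ∈ E.gradClosure hr :=
  Submodule.le_topologicalClosure _ (LinearMap.mem_range_self _ _)

theorem inner_gradMap_driftMap [VAddInvariantMeasure (Fin d → ℤ) Ω π]
    (hr : ∀ k, MemLp (E.r k) 2 π) (g : boundedMeasurable Ω) :
    inner ℝ (E.gradMap hr g) (E.driftMap hr g) = -(1 / 2) * ‖E.gradMap hr g‖ ^ 2 := by
  change inner ℝ (toFields _ _) (toFields _ _) = -(1 / 2) * ‖toFields _ _‖ ^ 2
  rw [inner_toFields, norm_toFields_sq]
  refine Eq.trans ?_ ((E.sum_integral_p_mul_grad_mul_self (E.integrable_p hr) g.2).trans ?_)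
  · refine Finset.sum_congr rfl fun k _ => integral_congr_ae ((E.r_pos k).mono fun ω h => ?_)
    simp only [mulR]
    field_simp
  · congr 1
    refine Finset.sum_congr rfl fun k _ => integral_congr_ae (Filter.Eventually.of_forall
      fun ω => ?_)
    simp only [mulR, mul_pow, r_sq]

/-- A bounded centred gradient field need not be the gradient of a function on `Ω`; ergodicity makes
it a limit of such gradients after multiplication by `R`. -/
theorem toFields_mulR_mem_gradClosure [IsProbabilityMeasure π] [ErgodicVAdd (Fin d → ℤ) Ω π]
    (hr : ∀ k, MemLp (E.r k) 2 π) {u : Step d → Ω → ℝ} (hu : MemGradient π ∞ u)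
    (hRu : ∀ k, MemLp (E.mulR u k) 2 π) :
    toFields (E.mulR u) hRu ∈ E.gradClosure hr := by
  choose u' hu' huu' using fun k => exists_isBddMeas_ae_eq (hu.2.1 k)
  rw [gradClosure, ← Submodule.orthogonal_orthogonal_eq_closure, Submodule.mem_orthogonal]
  intro v hv
  have hvr : ∀ k, Integrable (fun ω => v k ω * E.r k ω) π := fun k =>
    integrable_mul_of_memLp_two (Lp.memLp (v k)) (hr k)
  have horth : ∀ g, IsBddMeas g → ∑ k, ∫ ω, v k ω * E.r k ω * grad g k ω ∂π = 0 := by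
    intro g hg
    have := (Submodule.mem_orthogonal' _ _).1 hv _ (LinearMap.mem_range_self (E.gradMap hr) ⟨g, hg⟩)
    change inner ℝ v (toFields _ _) = 0 at this
    rw [inner_toFields_right] at this
    simpa only [mulR, ← mul_assoc] using this
  -- The gradient relation reads `u_k ∘ τ_l - u_k = ∇_k u_l`. One more translation step therefore
  -- changes the pairing by a pairing with the gradient of a bounded function, which `v`
  -- annihilates.
  have hstep : ∀ (l : Step d) (x : Fin d → ℤ),
      ∑ k, ∫ ω, v k ω * E.r k ω * u' k ((l.1 + x) +ᵥ ω) ∂π =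
        ∑ k, ∫ ω, v k ω * E.r k ω * u' k (x +ᵥ ω) ∂π := by
    intro l x
    rw [← sub_eq_zero, ← Finset.sum_sub_distrib, ← horth _ ((hu' l).vadd x)]
    refine Finset.sum_congr rfl fun k _ => ?_
    rw [← integral_sub (((hu' k).vadd _).integrable_mul (hvr k))
      (((hu' k).vadd _).integrable_mul (hvr k))]
    have hrel : ∀ᵐ ω ∂π, u' k ω + u' l (k.1 +ᵥ ω) = u' l ω + u' k (l.1 +ᵥ ω) := by
      filter_upwards [hu.1.2 k l, huu' k, huu' l, ae_vadd (huu' k) l.1, ae_vadd (huu' l) k.1]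
        with ω h h1 h2 h3 h4
      rw [← h1, ← h2, ← h3, ← h4, h]
    refine integral_congr_ae ((ae_vadd hrel x).mono fun ω h => ?_)
    simp only [grad]
    rw [add_vadd, vadd_comm x k.1 ω]
    linear_combination (-(v k ω * E.r k ω)) * h
  have hconst : ∀ x : Fin d → ℤ, ∑ k, ∫ ω, v k ω * E.r k ω * u' k (x +ᵥ ω) ∂π =
      ∑ k, ∫ ω, v k ω * E.r k ω * u' k ω ∂π :=
    lattice_induction (P := fun x _ => ∑ k, ∫ ω, v k ω * E.r k ω * u' k (x +ᵥ ω) ∂π =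
      ∑ k, ∫ ω, v k ω * E.r k ω * u' k ω ∂π) (by simp only [zero_vadd])
      fun l x _ hx => (hstep l x).trans hx
  rw [inner_toFields_right]
  have h0 := sum_integral_mul_eq_zero_of_forall_vadd_eq hvr hu' (fun k => by
    rw [← hu.2.2 k]; exact integral_congr_ae (huu' k).symm) hconst
  rw [← h0]
  refine Finset.sum_congr rfl fun k _ => integral_congr_ae ((huu' k).mono fun ω h => ?_)
  simp only [mulR]
  rw [h, mul_assoc]

end Environment
-- Energy limits of gradients.
namespace Environment

variable {d : ℕ} {Ω : Type*} [MeasurableSpace Ω] [AddAction (Fin d → ℤ) Ω] {π : Measure Ω}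
  (E : Environment d Ω π)

/-- The fields `w` which are limits of gradients of bounded functions in the energy norm
`‖R w‖_2`. -/
structure EnergyLimit (w : Step d → Ω → ℝ) : Prop where
  memLp : ∀ k, MemLp (E.mulR w k) 2 π
  approx : ∀ ε > 0, ∃ g : Ω → ℝ, IsBddMeas g ∧
    ∀ k, ∫ ω, E.mulR (w - grad g) k ω ^ 2 ∂π ≤ ε

variable {E}

theorem mulR_sub (u v : Step d → Ω → ℝ) : E.mulR (u - v) = E.mulR u - E.mulR v := by
  funext k ω; simp [mulR, mul_sub]

theorem mulR_mulRInv (u : Step d → Ω → ℝ) (k : Step d) : E.mulR (E.mulRInv u) k =ᵐ[π] u k :=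
  (E.r_pos k).mono fun _ h => mul_inv_cancel_left₀ h.ne' _

theorem mulRInv_mulR (u : Step d → Ω → ℝ) (k : Step d) : E.mulRInv (E.mulR u) k =ᵐ[π] u k :=
  (E.r_pos k).mono fun _ h => inv_mul_cancel_left₀ h.ne' _

omit [AddAction (Fin d → ℤ) Ω] in
theorem normTwo_sq (u : Step d → Ω → ℝ) : normTwo π u ^ 2 = 1 / 2 * ∑ k, ∫ ω, u k ω ^ 2 ∂π :=
  Real.sq_sqrt (mul_nonneg (by norm_num)
    (Finset.sum_nonneg fun _ _ => integral_nonneg fun _ => sq_nonneg _))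

omit [AddAction (Fin d → ℤ) Ω] in
theorem normTwo_nonneg (u : Step d → Ω → ℝ) : 0 ≤ normTwo π u := Real.sqrt_nonneg _

variable [MeasurableConstVAdd (Fin d → ℤ) Ω]

theorem EnergyLimit.memLp_sub (hr : ∀ k, MemLp (E.r k) 2 π) {w : Step d → Ω → ℝ}
    (hw : E.EnergyLimit w) {g : Ω → ℝ} (hg : IsBddMeas g) (k : Step d) :
    MemLp (E.mulR (w - grad g) k) 2 π := by
  rw [mulR_sub]; exact (hw.memLp k).sub (E.memLp_mulR_grad hr hg k)

theorem EnergyLimit.sub (hr : ∀ k, MemLp (E.r k) 2 π) {w w' : Step d → Ω → ℝ}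
    (hw : E.EnergyLimit w) (hw' : E.EnergyLimit w') : E.EnergyLimit (w - w') := by
  refine ⟨fun k => by rw [mulR_sub]; exact (hw.memLp k).sub (hw'.memLp k), fun ε hε => ?_⟩
  obtain ⟨g, hg, h⟩ := hw.approx (ε / 4) (by positivity)
  obtain ⟨g', hg', h'⟩ := hw'.approx (ε / 4) (by positivity)
  refine ⟨g - g', Submodule.sub_mem (boundedMeasurable Ω) hg hg', fun k => ?_⟩
  have i1 := (hw.memLp_sub hr hg k).integrable_sq
  have i2 := (hw'.memLp_sub hr hg' k).integrable_sq
  calc ∫ ω, E.mulR (w - w' - grad (g - g')) k ω ^ 2 ∂π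
      ≤ ∫ ω, (2 * E.mulR (w - grad g) k ω ^ 2 + 2 * E.mulR (w' - grad g') k ω ^ 2) ∂π := by
        refine integral_mono_of_nonneg (Filter.Eventually.of_forall fun _ => sq_nonneg _)
          ((i1.const_mul 2).add (i2.const_mul 2)) (Filter.Eventually.of_forall fun ω => ?_)
        have h : E.mulR (w - w' - grad (g - g')) k ω =
            E.mulR (w - grad g) k ω - E.mulR (w' - grad g') k ω := by
          simp only [mulR, grad, Pi.sub_apply]; ring
        change E.mulR (w - w' - grad (g - g')) k ω ^ 2 ≤ _
        rw [h]
        linarith [sq_nonneg (E.mulR (w - grad g) k ω + E.mulR (w' - grad g') k ω)]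
    _ ≤ ε := by
        rw [integral_add (i1.const_mul 2) (i2.const_mul 2), integral_const_mul, integral_const_mul]
        linarith [h k, h' k]

theorem energyLimit_of_mem_gradClosure (hr : ∀ k, MemLp (E.r k) 2 π) {w : Step d → Ω → ℝ}
    (hw : ∀ k, MemLp (E.mulR w k) 2 π) (h : toFields (E.mulR w) hw ∈ E.gradClosure hr) :
    E.EnergyLimit w := by
  refine ⟨hw, fun ε hε => ?_⟩
  obtain ⟨_, ⟨g, rfl⟩, hb⟩ := Metric.mem_closure_iff.1 h (√ε) (Real.sqrt_pos.2 hε)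
  refine ⟨g.1, g.2, fun k => ?_⟩
  change dist (toFields _ _) (toFields _ _) < _ at hb
  rw [dist_eq_norm, toFields_sub _ _, Real.lt_sqrt (norm_nonneg _), norm_toFields_sq,
    ← mulR_sub] at hb
  exact (Finset.single_le_sum (f := fun k => ∫ ω, E.mulR (w - grad g.1) k ω ^ 2 ∂π)
    (fun _ _ => integral_nonneg fun _ => sq_nonneg _) (Finset.mem_univ k)).trans hb.le

theorem MemRInvK2.energyLimit [IsProbabilityMeasure π] [ErgodicVAdd (Fin d → ℤ) Ω π]
    (hr : ∀ k, MemLp (E.r k) 2 π) {w : Step d → Ω → ℝ} (hw : E.MemRInvK2 w) :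
    E.EnergyLimit w := by
  obtain ⟨u, ⟨⟨-, hu⟩, happ⟩, hwu⟩ := hw
  have hRw : ∀ k, E.mulR w k =ᵐ[π] u k := fun k => by
    filter_upwards [hwu k, E.mulR_mulRInv u k] with ω h1 h2
    rw [← h2]; simp only [mulR]; rw [h1]
  have hRwL : ∀ k, MemLp (E.mulR w k) 2 π := fun k => (memLp_congr_ae (hRw k)).2 (hu k)
  refine energyLimit_of_mem_gradClosure hr hRwL ?_
  rw [toFields_congr hRwL hu hRw]
  refine (Submodule.isClosed_topologicalClosure _).closure_subset (Metric.mem_closure_iff.2 ?_)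
  intro ε hε
  obtain ⟨v, hv, hvu⟩ := happ (ε / 2) (by positivity)
  choose v' hv' hvv' using fun k => exists_isBddMeas_ae_eq (hv.2.1 k)
  have hRv : ∀ k, MemLp (E.mulR v k) 2 π := fun k =>
    (memLp_congr_ae ((hvv' k).mono fun ω h => by simp only [mulR]; rw [h])).2
      ((hv' k).memLp_mul (hr k))
  refine ⟨_, E.toFields_mulR_mem_gradClosure hr hv hRv, ?_⟩
  rw [dist_eq_norm, toFields_sub, ← sq_lt_sq₀ (norm_nonneg _) hε.le, norm_toFields_sq]
  have h1 := normTwo_sq (π := π) (u - E.mulR v)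
  nlinarith [normTwo_nonneg (π := π) (u - E.mulR v)]

section RInv

variable (hr : ∀ k, MemLp (E.r k) 2 π) (hrinv : ∀ k, MemLp (fun ω => (E.r k ω)⁻¹) 2 π)
include hrinv

omit [MeasurableConstVAdd (Fin d → ℤ) Ω] in
theorem integrable_of_memLp_mulR {w : Step d → Ω → ℝ} {k : Step d}
    (hw : MemLp (E.mulR w k) 2 π) : Integrable (w k) π :=
  (integrable_mul_of_memLp_two (hrinv k) hw).congr (mulRInv_mulR w k)

omit [MeasurableConstVAdd (Fin d → ℤ) Ω] in
theorem integral_abs_le_of_memLp_mulR {w : Step d → Ω → ℝ} {k : Step d}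
    (hw : MemLp (E.mulR w k) 2 π) :
    ∫ ω, |w k ω| ∂π ≤ √(∫ ω, (E.r k ω)⁻¹ ^ 2 ∂π) * √(∫ ω, E.mulR w k ω ^ 2 ∂π) := by
  refine le_trans (le_of_eq (integral_congr_ae ?_)) (integral_abs_mul_le (hrinv k) hw)
  filter_upwards [mulRInv_mulR w k] with ω h
  rw [← h]; rfl

include hr

/-- Cauchy–Schwarz against `r⁻¹ ∈ L²` turns energy approximation into `L¹` approximation by the same
potential. -/
theorem EnergyLimit.exists_approx {w : Step d → Ω → ℝ} (hw : E.EnergyLimit w) {ε : ℝ} (hε : 0 < ε) :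
    ∃ g : Ω → ℝ, IsBddMeas g ∧ (∀ k, ∫ ω, E.mulR (w - grad g) k ω ^ 2 ∂π ≤ ε) ∧
      ∀ k, ∫ ω, |w k ω - grad g k ω| ∂π ≤ ε := by
  let c := 1 + ∑ k, √(∫ ω, (E.r k ω)⁻¹ ^ 2 ∂π)
  have hc : 0 < c := add_pos_of_pos_of_nonneg one_pos
    (Finset.sum_nonneg fun _ _ => Real.sqrt_nonneg _)
  obtain ⟨g, hg, h⟩ := hw.approx (min ε ((ε / c) ^ 2)) (by positivity)
  refine ⟨g, hg, fun k => (h k).trans (min_le_left _ _), fun k => ?_⟩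
  refine (integral_abs_le_of_memLp_mulR hrinv (hw.memLp_sub hr hg k)).trans ?_
  have h1 : √(∫ ω, E.mulR (w - grad g) k ω ^ 2 ∂π) ≤ ε / c :=
    (Real.sqrt_le_sqrt ((h k).trans (min_le_right _ _))).trans_eq (Real.sqrt_sq (by positivity))
  have h2 : √(∫ ω, (E.r k ω)⁻¹ ^ 2 ∂π) ≤ c := by
    have := Finset.single_le_sum (f := fun k => √(∫ ω, (E.r k ω)⁻¹ ^ 2 ∂π))
      (fun _ _ => Real.sqrt_nonneg _) (Finset.mem_univ k)
    simp only [c]; linarith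
  calc _ ≤ c * (ε / c) := mul_le_mul h2 h1 (Real.sqrt_nonneg _) hc.le
    _ = ε := mul_div_cancel₀ _ hc.ne'

variable [VAddInvariantMeasure (Fin d → ℤ) Ω π]

theorem EnergyLimit.memGradient [IsFiniteMeasure π] {w : Step d → Ω → ℝ} (hw : E.EnergyLimit w) :
    MemGradient π 1 w := by
  have hwi : ∀ k, Integrable (w k) π := fun k => integrable_of_memLp_mulR hrinv (hw.memLp k)
  -- The defining relations are linear and hold exactly for gradients. The factor `4` covers the
  -- four terms of the gradient relation, each approximated up to `ε`.
  have hzero : ∀ {f : Ω → ℝ}, Integrable f π → (∀ ε > 0, ∫ ω, |f ω| ∂π ≤ 4 * ε) →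
      ∀ᵐ ω ∂π, f ω = 0 := by
    intro f hf h
    have h0 : ∫ ω, |f ω| ∂π = 0 := le_antisymm (le_of_forall_pos_le_add fun ε hε => by
      linarith [h (ε / 4) (by positivity)]) (integral_nonneg fun _ => abs_nonneg _)
    exact ((integral_eq_zero_iff_of_nonneg (fun _ => abs_nonneg _) hf.abs).1 h0).mono
      fun ω h => abs_eq_zero.1 h
  have hdi : ∀ {g : Ω → ℝ}, IsBddMeas g → ∀ (k : Step d) (x : Fin d → ℤ),
      Integrable (fun ω => |w k (x +ᵥ ω) - grad g k (x +ᵥ ω)|) π := fun hg k x =>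
    integrable_vadd (((hwi k).sub (memLp_one_iff_integrable.1 ((hg.grad k).memLp 1))).abs) x
  have hd0 : ∀ {g : Ω → ℝ}, IsBddMeas g → ∀ k : Step d,
      Integrable (fun ω => |w k ω - grad g k ω|) π := fun hg k =>
    ((hwi k).sub (memLp_one_iff_integrable.1 ((hg.grad k).memLp 1))).abs
  refine ⟨⟨⟨fun k => (hwi k).aemeasurable, fun k => ?_⟩, fun k l => ?_⟩,
    fun k => memLp_one_iff_integrable.2 (hwi k), fun k => ?_⟩
  · refine hzero ((hwi k).add (integrable_vadd (hwi (-k)) k.1)) fun ε hε => ?_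
    obtain ⟨g, hg, -, hg1⟩ := hw.exists_approx hr hrinv hε
    calc ∫ ω, |w k ω + w (-k) (k.1 +ᵥ ω)| ∂π
        ≤ ∫ ω, (|w k ω - grad g k ω| + |w (-k) (k.1 +ᵥ ω) - grad g (-k) (k.1 +ᵥ ω)|) ∂π := by
          refine integral_mono ((hwi k).add (integrable_vadd (hwi (-k)) k.1)).abs
            ((hd0 hg k).add (hdi hg (-k) k.1)) fun ω => ?_
          refine le_trans (le_of_eq ?_) (abs_add_le _ _)
          rw [grad_neg_vadd]; congr 1; ring
      _ ≤ 4 * ε := by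
          rw [integral_add (hd0 hg k) (hdi hg (-k) k.1),
            integral_vadd (μ := π) (fun ω => |w (-k) ω - grad g (-k) ω|)]
          linarith [hg1 k, hg1 (-k)]
  · have hi := (((hwi k).add (integrable_vadd (hwi l) k.1)).sub
      ((hwi l).add (integrable_vadd (hwi k) l.1)))
    refine (hzero hi fun ε hε => ?_).mono fun ω h => sub_eq_zero.1 h
    obtain ⟨g, hg, -, hg1⟩ := hw.exists_approx hr hrinv hε
    have i1 := (hd0 hg k).add (hdi hg l k.1)
    have i2 := (hd0 hg l).add (hdi hg k l.1)
    calc ∫ ω, |w k ω + w l (k.1 +ᵥ ω) - (w l ω + w k (l.1 +ᵥ ω))| ∂π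
        ≤ ∫ ω, ((|w k ω - grad g k ω| + |w l (k.1 +ᵥ ω) - grad g l (k.1 +ᵥ ω)|) +
            (|w l ω - grad g l ω| + |w k (l.1 +ᵥ ω) - grad g k (l.1 +ᵥ ω)|)) ∂π := by
          refine integral_mono hi.abs (i1.add i2) fun ω => ?_
          refine le_trans (le_of_eq ?_) ((abs_sub _ _).trans
            (add_le_add (abs_add_le _ _) (abs_add_le _ _)))
          congr 1
          simp only [grad]
          rw [vadd_comm l.1 k.1 ω]; ring
      _ ≤ 4 * ε := by
          refine (integral_add i1 i2).trans_le ?_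
          simp only [Pi.add_apply]
          rw [integral_add (hd0 hg k) (hdi hg l k.1),
            integral_add (hd0 hg l) (hdi hg k l.1),
            integral_vadd (μ := π) (fun ω => |w l ω - grad g l ω|),
            integral_vadd (μ := π) (fun ω => |w k ω - grad g k ω|)]
          linarith [hg1 k, hg1 l]
  · refine abs_eq_zero.1 (le_antisymm (le_of_forall_pos_le_add fun ε hε => ?_) (abs_nonneg _))
    obtain ⟨g, hg, -, hg1⟩ := hw.exists_approx hr hrinv hε
    have hgi := memLp_one_iff_integrable.1 (hg.memLp (π := π) 1)
    have h0 : ∫ ω, grad g k ω ∂π = 0 := by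
      simp only [grad]
      rw [integral_sub (integrable_vadd hgi k.1) hgi, integral_vadd, sub_self]
    have h1 := integral_sub (hwi k) (memLp_one_iff_integrable.1 ((hg.grad k).memLp (π := π) 1))
    rw [h0, sub_zero] at h1
    rw [← h1, zero_add]
    exact abs_integral_le_integral_abs.trans (hg1 k)

theorem EnergyLimit.memRInvK2 [IsFiniteMeasure π] {w : Step d → Ω → ℝ} (hw : E.EnergyLimit w) :
    E.MemRInvK2 w := by
  refine ⟨E.mulR w, ⟨⟨⟨fun k => (hw.memLp k).1.aemeasurable, fun k => ?_⟩, hw.memLp⟩, ?_⟩,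
    fun k => (mulRInv_mulR w k).symm⟩
  · filter_upwards [(hw.memGradient hr hrinv).1.1.2 k] with ω h
    simp only [mulR]
    rw [r_neg_vadd, ← mul_add, h, mul_zero]
  · intro ε hε
    obtain ⟨g, hg, hg2⟩ := hw.approx (ε ^ 2 / (Fintype.card (Step d) + 1)) (by positivity)
    refine ⟨grad g, ⟨isGradientField_grad π hg.measurable, fun k => (hg.grad k).memLp _,
      fun k => ?_⟩, ?_⟩
    · have hgi := memLp_one_iff_integrable.1 (hg.memLp (π := π) 1)
      simp only [grad]
      rw [integral_sub (integrable_vadd hgi k.1) hgi, integral_vadd, sub_self]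
    · rw [← sq_lt_sq₀ (normTwo_nonneg _) hε.le, normTwo_sq, ← mulR_sub]
      have := Finset.sum_le_sum fun k (_ : k ∈ Finset.univ) => hg2 k
      rw [Finset.sum_const, nsmul_eq_mul, Finset.card_univ, mul_div_assoc'] at this
      have h2 : (Fintype.card (Step d) : ℝ) * ε ^ 2 / (Fintype.card (Step d) + 1) ≤ ε ^ 2 := by
        rw [div_le_iff₀ (by positivity)]
        nlinarith [sq_nonneg ε]
      have : 0 < ε ^ 2 := by positivity
      linarith

end RInv

end Environment
-- Existence and norm bounds.
namespace Environment

variable {d : ℕ} {Ω : Type*} [MeasurableSpace Ω] [AddAction (Fin d → ℤ) Ω] {π : Measure Ω}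
  {E : Environment d Ω π} [MeasurableConstVAdd (Fin d → ℤ) Ω] [IsProbabilityMeasure π]

theorem memScalar_sub_integral {g : Ω → ℝ} (hg : IsBddMeas g) :
    MemScalar π ∞ fun ω => g ω - ∫ ω', g ω' ∂π := by
  refine ⟨(hg.memLp ∞).sub (memLp_const _), ?_⟩
  rw [integral_sub (memLp_one_iff_integrable.1 (hg.memLp 1)) (integrable_const _)]
  simp

omit [MeasurableConstVAdd (Fin d → ℤ) Ω] in
/-- The pairing with `φ ∈ 𝓗_-` is bounded by the Dirichlet norm. -/
theorem MemHMinus.abs_integral_mul_le {φ : Ω → ℝ}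
    (hφ : E.MemHMinus φ) {g : Ω → ℝ} (hg : IsBddMeas g) :
    |∫ ω, φ ω * g ω ∂π| ≤ E.normMinus φ * normTwo π (E.mulR (grad g)) := by
  have hφi := memLp_one_iff_integrable.1 hφ.1.1
  have hle : ∀ a ∈ E.dualValues φ, a ≤ sSup (E.dualValues φ) := fun a ha => le_csSup hφ.2 ha
  -- The test function `t • g` gives a quadratic polynomial in `t` that is nowhere negative; its
  -- discriminant is the claimed bound. Centring the test function changes nothing, since `φ` has
  -- mean zero and the gradient kills constants.
  have hquad : ∀ t : ℝ, 0 ≤ normTwo π (E.mulR (grad g)) ^ 2 * (t * t) +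
      (-2 * ∫ ω, φ ω * g ω ∂π) * t + sSup (E.dualValues φ) := by
    intro t
    have htg : IsBddMeas (t • g) := Submodule.smul_mem (boundedMeasurable Ω) t hg
    have h := hle _ ⟨_, memScalar_sub_integral (π := π) htg, rfl⟩
    have h1 : ∫ ω, φ ω * ((t • g) ω - ∫ ω', (t • g) ω' ∂π) ∂π = t * ∫ ω, φ ω * g ω ∂π := by
      have i1 : Integrable (fun ω => φ ω * (t • g) ω) π := htg.integrable_mul hφi
      simp only [mul_sub]
      rw [integral_sub i1 (hφi.mul_const _), integral_mul_const, hφ.1.2, zero_mul, sub_zero,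
        ← integral_const_mul]
      congr 1; funext ω; simp only [Pi.smul_apply, smul_eq_mul]; ring
    have h2 : normTwo π (E.mulR (grad fun ω => (t • g) ω - ∫ ω', (t • g) ω' ∂π)) ^ 2 =
        normTwo π (E.mulR (grad g)) ^ 2 * (t * t) := by
      rw [normTwo_sq, normTwo_sq, mul_assoc, Finset.sum_mul]
      simp_rw [← integral_mul_const]
      congr 1
      refine Finset.sum_congr rfl fun k _ => ?_
      congr 1; funext ω
      simp only [mulR, grad, Pi.smul_apply, smul_eq_mul]; ring
    rw [h1, h2] at h
    linarith
  have hdisc := discrim_le_zero hquad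
  have hS : 0 ≤ sSup (E.dualValues φ) := by simpa using hquad 0
  rw [discrim] at hdisc
  refine abs_le_of_sq_le_sq ?_ (mul_nonneg (Real.sqrt_nonneg _) (normTwo_nonneg _))
  rw [mul_pow, normMinus, Real.sq_sqrt hS]
  linarith

omit [AddAction (Fin d → ℤ) Ω] [MeasurableConstVAdd (Fin d → ℤ) Ω] [IsProbabilityMeasure π] in
theorem normTwo_eq_norm_toFields {u : Step d → Ω → ℝ} (hu : ∀ k, MemLp (u k) 2 π) :
    normTwo π u = ‖toFields u hu‖ / √2 := by
  rw [← sq_eq_sq₀ (normTwo_nonneg _) (by positivity), normTwo_sq, div_pow, norm_toFields_sq,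
    Real.sq_sqrt two_pos.le]
  ring

omit [MeasurableConstVAdd (Fin d → ℤ) Ω] [IsProbabilityMeasure π] in
-- Cauchy–Schwarz is used twice, over `Ω` and over the steps; the factors `½` of the norms match.
theorem normOne_le (hrinv : ∀ k, MemLp (fun ω => (E.r k ω)⁻¹) 2 π) {w : Step d → Ω → ℝ}
    (hw : ∀ k, MemLp (E.mulR w k) 2 π) :
    normOne π w ≤ normTwo π (fun k ω => (E.r k ω)⁻¹) * normTwo π (E.mulR w) := by
  have h1 : normOne π w ≤ 1 / 2 * ∑ k, √(∫ ω, (E.r k ω)⁻¹ ^ 2 ∂π) *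
      √(∫ ω, E.mulR w k ω ^ 2 ∂π) :=
    mul_le_mul_of_nonneg_left
      (Finset.sum_le_sum fun k _ => integral_abs_le_of_memLp_mulR hrinv (hw k)) (by norm_num)
  refine h1.trans ?_
  have h2 := Finset.sum_mul_sq_le_sq_mul_sq Finset.univ
    (fun k => √(∫ ω, (E.r k ω)⁻¹ ^ 2 ∂π)) (fun k => √(∫ ω, E.mulR w k ω ^ 2 ∂π))
  have h3 : ∀ f : Step d → Ω → ℝ, ∑ k, √(∫ ω, f k ω ^ 2 ∂π) ^ 2 = 2 * normTwo π f ^ 2 := by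
    intro f
    rw [normTwo_sq]
    simp_rw [Real.sq_sqrt (integral_nonneg fun ω => sq_nonneg (f _ ω))]
    ring
  rw [h3 fun k ω => (E.r k ω)⁻¹, h3 (E.mulR w)] at h2
  refine le_trans (le_abs_self _)
    (abs_le_of_sq_le_sq ?_ (mul_nonneg (normTwo_nonneg _) (normTwo_nonneg _)))
  nlinarith

theorem MemHMinus.exists_solution [VAddInvariantMeasure (Fin d → ℤ) Ω π]
    (hr : ∀ k, MemLp (E.r k) 2 π) {φ : Ω → ℝ} (hφ : E.MemHMinus φ) :
    ∃ w : Step d → Ω → ℝ, E.EnergyLimit w ∧ E.SolvesHarmonic w φ ∧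
      normTwo π (E.mulR w) ≤ E.normMinus φ := by
  have hφi := memLp_one_iff_integrable.1 hφ.1.1
  let F : boundedMeasurable Ω →ₗ[ℝ] ℝ :=
    { toFun := fun g => ∫ ω, φ ω * g.1 ω ∂π
      map_add' := fun f g => by
        rw [← integral_add (IsBddMeas.integrable_mul f.2 hφi) (IsBddMeas.integrable_mul g.2 hφi)]
        congr 1; funext ω; simp [mul_add]
      map_smul' := fun c g => by
        rw [RingHom.id_apply, smul_eq_mul, ← integral_const_mul]
        congr 1; funext ω; simp; ring }
  have : CompleteSpace (E.gradClosure hr) :=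
    (Submodule.isClosed_topologicalClosure _).completeSpace_coe
  -- The Hilbert norm lacks the factor `½`, so it equals `√2` times `normTwo`. With `a = 1 / 2` and
  -- `c = ‖φ‖_- / √2` the bound `c / a = √2 ‖φ‖_-` is exactly `‖R w‖_2 ≤ ‖φ‖_-`.
  obtain ⟨u, huK, hun, hu⟩ := exists_forall_inner_eq_of_coercive (E.gradClosure hr) (E.gradMap hr)
    (E.driftMap hr) F (a := 1 / 2) (c := E.normMinus φ / √2) (by norm_num)
    (div_nonneg (Real.sqrt_nonneg _) (Real.sqrt_nonneg _))
    (E.gradMap_mem_gradClosure hr) (fun g => by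
      rw [inner_gradMap_driftMap, abs_mul, abs_of_nonneg (sq_nonneg ‖E.gradMap hr g‖)]
      norm_num) (fun g => by
      refine (hφ.abs_integral_mul_le g.2).trans_eq ?_
      rw [normTwo_eq_norm_toFields (E.memLp_mulR_grad hr g.2)]
      change _ = E.normMinus φ / √2 * ‖toFields _ _‖
      ring)
  have huL : ∀ k, MemLp (u k) 2 π := fun k => Lp.memLp (u k)
  have hRw : ∀ k, E.mulR (E.mulRInv fun k => u k) k =ᵐ[π] u k := mulR_mulRInv _
  have hRwL : ∀ k, MemLp (E.mulR (E.mulRInv fun k => u k) k) 2 π := fun k =>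
    (memLp_congr_ae (hRw k)).2 (huL k)
  have hto : toFields _ hRwL = u := (toFields_congr hRwL huL hRw).trans (toFields_coeFn u)
  refine ⟨E.mulRInv fun k => u k, energyLimit_of_mem_gradClosure hr hRwL (by rwa [hto]), ?_, ?_⟩
  · have hpi : ∀ k, Integrable (fun ω => u k ω * (E.p k ω / E.r k ω)) π := fun k =>
      integrable_mul_of_memLp_two (huL k) (E.memLp_p_div_r hr k)
    have heq : ∀ k ω, E.p k ω * E.mulRInv (fun k => u k) k ω = u k ω * (E.p k ω / E.r k ω) := by
      intro k ω; simp only [mulRInv, div_eq_mul_inv]; ring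
    have hsum : Integrable (fun ω => ∑ k, E.p k ω * E.mulRInv (fun k => u k) k ω) π := by
      simp only [heq]
      exact integrable_finsetSum _ fun k _ => hpi k
    -- Indicators are admissible test functions, so the weak equation holds almost surely.
    refine hsum.ae_eq_of_forall_setIntegral_eq _ _ hφi fun A hA _ => ?_
    have hind : IsBddMeas (A.indicator fun _ : Ω => (1 : ℝ)) :=
      ⟨measurable_const.indicator hA, 1, fun ω => by
        by_cases h : ω ∈ A <;> simp [h]⟩
    have h := hu ⟨_, hind⟩
    change inner ℝ u (toFields _ _) = ∫ ω, φ ω * A.indicator (fun _ : Ω => (1 : ℝ)) ω ∂π at h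
    rw [inner_toFields_right] at h
    have hmul : ∀ f : Ω → ℝ, ∫ ω in A, f ω ∂π = ∫ ω, f ω * A.indicator (fun _ => (1 : ℝ)) ω ∂π := by
      intro f
      rw [← integral_indicator hA]
      congr 1; funext ω
      by_cases hω : ω ∈ A <;> simp [hω]
    rw [hmul, hmul, ← h]
    simp only [heq, Finset.sum_mul]
    rw [integral_finsetSum _ fun k _ => hind.integrable_mul (hpi k)]
    simp only [mul_assoc]
  · rw [normTwo_eq_norm_toFields hRwL, hto, div_le_iff₀ (by positivity)]
    refine hun.trans_eq ?_
    field_simp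
    rw [Real.sq_sqrt zero_le_two, mul_comm]

end Environment
-- Summation by parts with the stream tensor, for an invariant measure that may be infinite.
namespace Environment

variable {d : ℕ} {Ω : Type*} [MeasurableSpace Ω] [AddAction (Fin d → ℤ) Ω] {μ : Measure Ω}
  (E : Environment d Ω μ) [MeasurableConstVAdd (Fin d → ℤ) Ω]
  [VAddInvariantMeasure (Fin d → ℤ) Ω μ]

/-- The antisymmetric part of the jump rates. -/
noncomputable def b (k : Step d) (ω : Ω) : ℝ := (E.p k ω - E.p (-k) (k.1 +ᵥ ω)) / 2

omit [MeasurableConstVAdd (Fin d → ℤ) Ω] [VAddInvariantMeasure (Fin d → ℤ) Ω μ] in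
theorem p_eq_s_add_b (k : Step d) (ω : Ω) : E.p k ω = E.s k ω + E.b k ω := by
  simp only [s, b]; ring

omit [MeasurableConstVAdd (Fin d → ℤ) Ω] [VAddInvariantMeasure (Fin d → ℤ) Ω μ] in
theorem b_neg_vadd (k : Step d) (ω : Ω) : E.b (-k) (k.1 +ᵥ ω) = -E.b k ω := by
  simp only [b, coe_neg_step, neg_step_vadd_step_vadd, neg_neg]; ring

omit [MeasurableConstVAdd (Fin d → ℤ) Ω] [VAddInvariantMeasure (Fin d → ℤ) Ω μ] in
theorem sum_b : ∀ᵐ ω ∂μ, ∑ k, E.b k ω = 0 := by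
  filter_upwards [E.bistochastic] with ω h
  simp only [b]
  rw [← Finset.sum_div, Finset.sum_sub_distrib, h, sub_self, zero_div]

variable {E} {η F : Ω → ℝ}

/-- Symmetric part of the flux through the localising function `η`. -/
theorem sum_integral_s_mul_grad
    (hs : ∀ (k : Step d) (x : Fin d → ℤ), Integrable (fun ω => E.s k ω * η (x +ᵥ ω)) μ)
    (hF : IsBddMeas F) :
    ∑ k, ∫ ω, E.s k ω * η ω * grad F k ω ∂μ =
      -(1 / 2) * ∑ k, ∫ ω, E.s k ω * grad η k ω * grad F k ω ∂μ := by
  have i1 : ∀ k : Step d, Integrable (fun ω => E.s k ω * η ω * grad F k ω) μ := fun k =>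
    (hF.grad k).integrable_mul (by simpa using hs k 0)
  have i2 : ∀ k : Step d, Integrable (fun ω => E.s k ω * η (k.1 +ᵥ ω) * grad F k ω) μ := fun k =>
    (hF.grad k).integrable_mul (hs k k.1)
  have h1 := sum_integral_flip (μ := μ) fun k ω => E.s k ω * η ω * grad F k ω
  simp only [s_neg_vadd, grad_neg_vadd, mul_neg, integral_neg, Finset.sum_neg_distrib] at h1
  have h2 : ∀ k, ∫ ω, E.s k ω * grad η k ω * grad F k ω ∂μ =
      ∫ ω, E.s k ω * η (k.1 +ᵥ ω) * grad F k ω ∂μ - ∫ ω, E.s k ω * η ω * grad F k ω ∂μ := by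
    intro k
    rw [← integral_sub (i2 k) (i1 k)]
    congr 1; funext ω; simp only [grad]; ring
  simp_rw [h2]
  rw [Finset.sum_sub_distrib]
  linarith

/-- Reversing the `l`-bond changes the sign of `h k l`, so averaging both readings leaves only
differences of `A`. -/
theorem sum_integral_h_mul (k : Step d) {A : Ω → ℝ}
    (hi : ∀ (l : Step d) (x : Fin d → ℤ), Integrable (fun ω => E.h k l ω * A (x +ᵥ ω)) μ) :
    ∑ l, ∫ ω, E.h k l ω * A ω ∂μ = -(1 / 2) * ∑ l, ∫ ω, E.h k l ω * grad A l ω ∂μ := by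
  have h1 := sum_integral_flip (μ := μ) fun l ω => E.h k l ω * A ω
  have h2 : ∀ l : Step d, ∫ ω, E.h k (-l) (l.1 +ᵥ ω) * A (l.1 +ᵥ ω) ∂μ =
      -∫ ω, E.h k l ω * A (l.1 +ᵥ ω) ∂μ := by
    intro l
    rw [← integral_neg]
    refine integral_congr_ae ((E.h_neg_right k l).mono fun ω h => ?_)
    simp only [h]; ring
  simp_rw [h2] at h1
  have h3 : ∀ l, ∫ ω, E.h k l ω * grad A l ω ∂μ =
      ∫ ω, E.h k l ω * A (l.1 +ᵥ ω) ∂μ - ∫ ω, E.h k l ω * A ω ∂μ := by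
    intro l
    have := integral_sub (hi l l.1) (by simpa using hi l 0)
    rw [← this]
    congr 1; funext ω; simp only [grad]; ring
  simp_rw [h3]
  rw [Finset.sum_neg_distrib] at h1
  rw [Finset.sum_sub_distrib]
  linarith

omit [MeasurableConstVAdd (Fin d → ℤ) Ω] [VAddInvariantMeasure (Fin d → ℤ) Ω μ] in
theorem sum_integral_h_mul_symm {C : Step d → Step d → Ω → ℝ} (hC : ∀ k l ω, C k l ω = C l k ω) :
    ∑ k, ∑ l, ∫ ω, E.h k l ω * C k l ω ∂μ = 0 := by
  have h : ∑ k, ∑ l, ∫ ω, E.h k l ω * C k l ω ∂μ = -∑ k, ∑ l, ∫ ω, E.h k l ω * C k l ω ∂μ := by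
    conv_lhs => rw [Finset.sum_comm]
    rw [← Finset.sum_neg_distrib]
    refine Finset.sum_congr rfl fun l _ => ?_
    rw [← Finset.sum_neg_distrib]
    refine Finset.sum_congr rfl fun k _ => ?_
    rw [← integral_neg]
    refine integral_congr_ae ((E.h_swap k l).mono fun ω h => ?_)
    simp only [h, hC k l]; ring
  linarith

/-- Antisymmetric part of the flux through the localising function `η`. -/
theorem sum_integral_b_mul_grad
    (hb : ∀ (k : Step d) (x : Fin d → ℤ), Integrable (fun ω => E.b k ω * η (x +ᵥ ω)) μ)
    (hh : ∀ (k l : Step d) (x : Fin d → ℤ), Integrable (fun ω => E.h k l ω * η (x +ᵥ ω)) μ)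
    (hF : IsBddMeas F) :
    ∑ k, ∫ ω, E.b k ω * η ω * grad F k ω ∂μ =
      1 / 2 * ∑ k, ∑ l, ∫ ω, E.h k l ω * grad η k (l.1 +ᵥ ω) * grad F l ω ∂μ := by
  have hb0 : ∀ k : Step d, Integrable (fun ω => E.b k ω * η ω) μ := fun k => by
    simpa using hb k 0
  have i1 : ∀ k : Step d, Integrable (fun ω => E.b k ω * η ω * F (k.1 +ᵥ ω)) μ := fun k =>
    (hF.vadd k.1).integrable_mul (hb0 k)
  have i2 : ∀ k : Step d, Integrable (fun ω => E.b k ω * η ω * F ω) μ := fun k =>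
    hF.integrable_mul (hb0 k)
  have i3 : ∀ k : Step d, Integrable (fun ω => E.b k ω * η (k.1 +ᵥ ω) * F ω) μ := fun k =>
    hF.integrable_mul (hb k k.1)
  have hz : ∑ k, ∫ ω, E.b k ω * η ω * F ω ∂μ = 0 := by
    rw [← integral_finsetSum _ fun k _ => i2 k]
    refine integral_eq_zero_of_ae (E.sum_b.mono fun ω h => ?_)
    change ∑ k, E.b k ω * η ω * F ω = 0
    rw [← Finset.sum_mul, ← Finset.sum_mul, h]; ring
  have h1 := sum_integral_flip (μ := μ) fun k ω => E.b k ω * η ω * F (k.1 +ᵥ ω)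
  simp only [b_neg_vadd, coe_neg_step, neg_step_vadd_step_vadd, neg_mul, integral_neg,
    Finset.sum_neg_distrib] at h1
  -- Bond reversal and `∑ b_k = 0` move the gradient from `F` to `η`.
  have h2 : ∑ k, ∫ ω, E.b k ω * η ω * grad F k ω ∂μ =
      -∑ k, ∫ ω, E.b k ω * (grad η k ω * F ω) ∂μ := by
    have e1 : ∀ k, ∫ ω, E.b k ω * η ω * grad F k ω ∂μ =
        ∫ ω, E.b k ω * η ω * F (k.1 +ᵥ ω) ∂μ - ∫ ω, E.b k ω * η ω * F ω ∂μ := fun k => by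
      rw [← integral_sub (i1 k) (i2 k)]
      congr 1; funext ω; simp only [grad]; ring
    have e2 : ∀ k, ∫ ω, E.b k ω * (grad η k ω * F ω) ∂μ =
        ∫ ω, E.b k ω * η (k.1 +ᵥ ω) * F ω ∂μ - ∫ ω, E.b k ω * η ω * F ω ∂μ := fun k => by
      rw [← integral_sub (i3 k) (i2 k)]
      congr 1; funext ω; simp only [grad]; ring
    simp_rw [e1, e2]
    rw [Finset.sum_sub_distrib, Finset.sum_sub_distrib, hz]
    linarith
  have ih : ∀ (k l : Step d) (x y : Fin d → ℤ),
      Integrable (fun ω => E.h k l ω * (grad η k (x +ᵥ ω) * F (y +ᵥ ω))) μ := by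
    intro k l x y
    have := (hF.vadd y).integrable_mul ((hh k l (k.1 + x)).sub (hh k l x))
    refine this.congr (Filter.Eventually.of_forall fun ω => ?_)
    simp only [grad, add_vadd, Pi.sub_apply]; ring
  have h3 : ∀ k, ∫ ω, E.b k ω * (grad η k ω * F ω) ∂μ =
      ∑ l, ∫ ω, E.h k l ω * (grad η k ω * F ω) ∂μ := by
    intro k
    rw [← integral_finsetSum _ fun l _ => by simpa using ih k l 0 0]
    refine integral_congr_ae ((E.divergence_form k).mono fun ω h => ?_)
    change E.b k ω * _ = _
    simp only [← Finset.sum_mul]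
    rw [← h, b]
  -- By the discrete Leibniz rule one term carries the second difference of `η`. It is symmetric in
  -- `k`, `l` and cancels against the antisymmetric `h`. Thus `F`, which may be of order `M²` in the
  -- application, enters only through its gradient, of order `M`.
  have h4 : ∀ k l, ∫ ω, E.h k l ω * grad (fun ω => grad η k ω * F ω) l ω ∂μ =
      ∫ ω, E.h k l ω * grad η k (l.1 +ᵥ ω) * grad F l ω ∂μ +
        ∫ ω, E.h k l ω * (grad (grad η k) l ω * F ω) ∂μ := by
    intro k l
    rw [← integral_add]
    · congr 1; funext ω; simp only [grad]; ring
    · have := (ih k l l.1 l.1).sub (ih k l l.1 0)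
      refine this.congr (Filter.Eventually.of_forall fun ω => ?_)
      simp only [grad, Pi.sub_apply, zero_vadd]; ring
    · have := (ih k l l.1 0).sub (ih k l 0 0)
      refine this.congr (Filter.Eventually.of_forall fun ω => ?_)
      simp only [grad, Pi.sub_apply, zero_vadd]; ring
  rw [h2]
  simp_rw [h3]
  simp_rw [fun k => sum_integral_h_mul (E := E) k (A := fun ω => grad η k ω * F ω)
    fun l x => ih k l x x, h4, Finset.sum_add_distrib, ← Finset.mul_sum, Finset.sum_add_distrib]
  rw [sum_integral_h_mul_symm (E := E) (C := fun k l ω => grad (grad η k) l ω * F ω)]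
  · ring
  · intro k l ω
    simp only [grad]
    rw [vadd_comm l.1 k.1 ω]; ring

theorem sum_integral_p_mul_grad_localised
    (hp : ∀ (k : Step d) (x : Fin d → ℤ), Integrable (fun ω => E.p k ω * η (x +ᵥ ω)) μ)
    (hh : ∀ (k l : Step d) (x : Fin d → ℤ), Integrable (fun ω => E.h k l ω * η (x +ᵥ ω)) μ)
    (hF : IsBddMeas F) :
    ∑ k, ∫ ω, E.p k ω * η ω * grad F k ω ∂μ =
      1 / 2 * ∑ k, ∑ l, ∫ ω, E.h k l ω * grad η k (l.1 +ᵥ ω) * grad F l ω ∂μ -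
      1 / 2 * ∑ k, ∫ ω, E.s k ω * grad η k ω * grad F k ω ∂μ := by
  have hp' : ∀ (k : Step d) (x : Fin d → ℤ),
      Integrable (fun ω => E.p (-k) (k.1 +ᵥ ω) * η (x +ᵥ ω)) μ := by
    intro k x
    refine (integrable_vadd (hp (-k) (x - k.1)) k.1).congr (Filter.Eventually.of_forall fun ω => ?_)
    simp only [vadd_vadd, sub_add_cancel]
  have hs : ∀ (k : Step d) (x : Fin d → ℤ), Integrable (fun ω => E.s k ω * η (x +ᵥ ω)) μ :=
    fun k x => (((hp k x).add (hp' k x)).div_const 2).congr (Filter.Eventually.of_forall fun ω => by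
      simp only [s, Pi.add_apply]; ring)
  have hb : ∀ (k : Step d) (x : Fin d → ℤ), Integrable (fun ω => E.b k ω * η (x +ᵥ ω)) μ :=
    fun k x => (((hp k x).sub (hp' k x)).div_const 2).congr (Filter.Eventually.of_forall fun ω => by
      simp only [b, Pi.sub_apply]; ring)
  have h : ∀ k, ∫ ω, E.p k ω * η ω * grad F k ω ∂μ =
      ∫ ω, E.s k ω * η ω * grad F k ω ∂μ + ∫ ω, E.b k ω * η ω * grad F k ω ∂μ := by
    intro k
    rw [← integral_add ((hF.grad k).integrable_mul (by simpa using hs k 0))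
      ((hF.grad k).integrable_mul (by simpa using hb k 0))]
    congr 1; funext ω; rw [p_eq_s_add_b]; ring
  simp_rw [h]
  rw [Finset.sum_add_distrib, sum_integral_s_mul_grad hs hF, sum_integral_b_mul_grad hb hh hF]
  ring

end Environment

/-! ### The product of lattice and environment, with the diagonal action. -/

section Product

variable {d : ℕ} {Ω : Type*} [MeasurableSpace Ω] [AddAction (Fin d → ℤ) Ω] {π : Measure Ω}

instance [MeasurableConstVAdd (Fin d → ℤ) Ω] :
    MeasurableConstVAdd (Fin d → ℤ) ((Fin d → ℤ) × Ω) :=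
  ⟨fun k => (measurable_const_vadd k).prodMap (measurable_const_vadd k)⟩

instance [MeasurableConstVAdd (Fin d → ℤ) Ω] [SFinite π] [VAddInvariantMeasure (Fin d → ℤ) Ω π] :
    VAddInvariantMeasure (Fin d → ℤ) ((Fin d → ℤ) × Ω) (Measure.count.prod π) :=
  ⟨fun k _ hs => ((measurePreserving_vadd k Measure.count).prod
    (measurePreserving_vadd k π)).measure_preimage hs.nullMeasurableSet⟩

omit [AddAction (Fin d → ℤ) Ω] in
theorem ae_prod_count [SFinite π] {P : Ω → Prop} (h : ∀ᵐ ω ∂π, P ω) :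
    ∀ᵐ z ∂((Measure.count : Measure (Fin d → ℤ)).prod π), P z.2 :=
  Measure.quasiMeasurePreserving_snd.ae h

/-- The environment seen from all lattice points. -/
def Environment.lift [SFinite π] (E : Environment d Ω π) :
    Environment d ((Fin d → ℤ) × Ω) (Measure.count.prod π) where
  p k z := E.p k z.2
  h k l z := E.h k l z.2
  measurable_p k := (E.measurable_p k).comp measurable_snd
  measurable_h k l := (E.measurable_h k l).comp measurable_snd
  p_nonneg k z := E.p_nonneg k z.2
  bistochastic := ae_prod_count E.bistochastic
  weakly_elliptic k := ae_prod_count (E.weakly_elliptic k)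
  h_neg_left k l := ae_prod_count (E.h_neg_left k l)
  h_neg_right k l := ae_prod_count (E.h_neg_right k l)
  h_swap k l := ae_prod_count (E.h_swap k l)
  divergence_form k := ae_prod_count (E.divergence_form k)

end Product

/-! ### Følner functions on boxes. -/

section Box

variable {d : ℕ}

theorem exists_eq_zero_of_ne (k : Step d) : ∃ i, |k.1 i| = 1 ∧ ∀ j, j ≠ i → k.1 j = 0 := by
  have hk := (mem_steps _).1 k.2
  obtain ⟨i, hi⟩ : ∃ i, k.1 i ≠ 0 := by
    by_contra! h
    simp [h] at hk
  have h1 := Finset.add_sum_erase Finset.univ (fun j => |k.1 j|) (Finset.mem_univ i)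
  have h2 : 0 ≤ ∑ j ∈ Finset.univ.erase i, |k.1 j| := Finset.sum_nonneg fun _ _ => abs_nonneg _
  have h3 : 1 ≤ |k.1 i| := Int.one_le_abs hi
  rw [hk] at h1
  refine ⟨i, by omega, fun j hj => ?_⟩
  have h4 := (Finset.sum_eq_zero_iff_of_nonneg fun j _ => abs_nonneg (k.1 j)).1
    (by omega : ∑ j ∈ Finset.univ.erase i, |k.1 j| = 0) j (by simp [hj])
  exact abs_eq_zero.1 h4

theorem integral_count_indicator (A : Finset (Fin d → ℤ)) (c : ℝ) :
    ∫ x, (A : Set (Fin d → ℤ)).indicator (fun _ => c) x ∂Measure.count = A.card * c := by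
  rw [integral_indicator A.measurableSet, setIntegral_const, smul_eq_mul, Measure.real,
    Measure.count_apply_finset, ENNReal.toReal_natCast]

theorem integrable_count_indicator (A : Finset (Fin d → ℤ)) (c : ℝ) :
    Integrable ((A : Set (Fin d → ℤ)).indicator fun _ => c) Measure.count := by
  refine (integrable_indicator_iff A.measurableSet).2 (integrableOn_const ?_)
  rw [Measure.count_apply_finset]
  exact ENNReal.natCast_ne_top _

/-- The box `[0, N)^d`. -/
noncomputable def box (d N : ℕ) : Finset (Fin d → ℤ) := Fintype.piFinset fun _ => Finset.Ico 0 (N : ℤ)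

/-- Points leaving the box in one step lie on a single face, where the coordinate moved by `k` is
fixed; it has `N ^ (d - 1)` points. -/
theorem card_box_diff_le (N : ℕ) (k : Step d) :
    (((box d N).filter fun x => k.1 + x ∉ box d N).card : ℝ) * N ≤ (N : ℝ) ^ d := by
  obtain ⟨i, hi, hj⟩ := exists_eq_zero_of_ne k
  obtain ⟨v, hv⟩ : ∃ v : ℤ, ∀ a : ℤ, a ∈ Finset.Ico 0 (N : ℤ) → k.1 i + a ∉ Finset.Ico 0 (N : ℤ) →
      a = v := by
    rcases (abs_eq zero_le_one).1 hi with h | h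
    · refine ⟨N - 1, fun a ha hb => ?_⟩
      rw [h] at hb; simp only [Finset.mem_Ico] at ha hb; omega
    · refine ⟨0, fun a ha hb => ?_⟩
      rw [h] at hb; simp only [Finset.mem_Ico] at ha hb; omega
  have hsub : (box d N).filter (fun x => k.1 + x ∉ box d N) ⊆
      Fintype.piFinset (Function.update (fun _ => Finset.Ico 0 (N : ℤ)) i {v}) := by
    intro x hx
    rw [Finset.mem_filter, box, Fintype.mem_piFinset, Fintype.mem_piFinset] at hx
    obtain ⟨hx, hkx⟩ := hx
    rw [Fintype.mem_piFinset]
    intro j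
    by_cases h : j = i
    · subst h
      rw [Function.update_self, Finset.mem_singleton]
      refine hv _ (hx j) fun h' => hkx fun m => ?_
      by_cases hm : m = j
      · subst hm; exact h'
      · rw [Pi.add_apply, hj m hm, zero_add]; exact hx m
    · rw [Function.update_of_ne h]; exact hx j
  have hcard := Finset.card_le_card hsub
  rw [Fintype.card_piFinset, ← Finset.mul_prod_erase _ _ (Finset.mem_univ i), Function.update_self,
    Finset.card_singleton, one_mul, Finset.prod_congr rfl (g := fun _ => N) (fun j hj => by
      rw [Function.update_of_ne (Finset.ne_of_mem_erase hj), Int.card_Ico]; simp),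
    Finset.prod_const, Finset.card_erase_of_mem (Finset.mem_univ i), Finset.card_univ,
    Fintype.card_fin] at hcard
  have hd : 0 < d := Fin.pos i
  calc _ ≤ ((N ^ (d - 1) : ℕ) : ℝ) * N := by gcongr
    _ = (N : ℝ) ^ d := by rw [Nat.cast_pow, ← pow_succ, Nat.sub_add_cancel hd]

/-- Følner functions on the lattice. -/
theorem exists_folner (d : ℕ) {N : ℕ} (hN : 0 < N) :
    ∃ θ : (Fin d → ℤ) → ℝ, (∀ x, 0 ≤ θ x) ∧ (∀ x, θ x ≠ 0 → ∑ i, |x i| ≤ d * N) ∧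
      Integrable θ Measure.count ∧ ∫ x, θ x ∂Measure.count = 1 ∧
      ∀ k : Step d, ∫ x, |θ (k.1 + x) - θ x| ∂Measure.count ≤ 2 / N := by
  have hN' : (0 : ℝ) < N := by exact_mod_cast hN
  have hc : (0 : ℝ) < (N : ℝ) ^ d := by positivity
  refine ⟨((box d N : Finset _) : Set (Fin d → ℤ)).indicator fun _ => ((N : ℝ) ^ d)⁻¹, fun x => ?_,
    fun x hx => ?_, integrable_count_indicator _ _, ?_, fun k => ?_⟩
  · exact Set.indicator_nonneg (fun _ _ => by positivity) x
  · have hx' := Finset.mem_coe.1 (Set.mem_of_indicator_ne_zero hx)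
    rw [box, Fintype.mem_piFinset] at hx'
    calc ∑ i, |x i| ≤ ∑ i : Fin d, (N : ℤ) := Finset.sum_le_sum fun i _ => by
          have := Finset.mem_Ico.1 (hx' i)
          rw [abs_of_nonneg this.1]; exact this.2.le
      _ = d * N := by simp
  · rw [integral_count_indicator, box, Fintype.card_piFinset]
    simp [hc.ne']
  · let Q : Step d → Finset (Fin d → ℤ) := fun k => (box d N).filter fun x => k.1 + x ∉ box d N
    let f : Step d → (Fin d → ℤ) → ℝ := fun k =>
      (Q k : Set (Fin d → ℤ)).indicator fun _ => ((N : ℝ) ^ d)⁻¹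
    have hfi : ∀ k, Integrable (f k) Measure.count := fun k => integrable_count_indicator _ _
    have hf : ∀ k, ∫ x, f k x ∂Measure.count ≤ 1 / N := by
      intro k
      rw [integral_count_indicator, ← div_eq_mul_inv, div_le_div_iff₀ hc hN', one_mul]
      exact card_box_diff_le N k
    have hshift : ∫ x, f (-k) (k.1 + x) ∂Measure.count = ∫ x, f (-k) x ∂Measure.count :=
      integral_vadd (μ := (Measure.count : Measure (Fin d → ℤ))) (f (-k)) k.1
    have hsi : Integrable (fun x => f (-k) (k.1 + x)) Measure.count :=
      integrable_vadd (μ := (Measure.count : Measure (Fin d → ℤ))) (hfi (-k)) k.1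
    calc _ ≤ ∫ x, (f k x + f (-k) (k.1 + x)) ∂Measure.count := by
          refine integral_mono_of_nonneg (Filter.Eventually.of_forall fun _ => abs_nonneg _)
            ((hfi k).add hsi) (Filter.Eventually.of_forall fun x => ?_)
          have hpos : 0 ≤ ((N : ℝ) ^ d)⁻¹ := by positivity
          by_cases h1 : x ∈ box d N <;> by_cases h2 : k.1 + x ∈ box d N <;>
            simp [f, Q, Set.indicator, h1, h2]
      _ ≤ 2 / N := by
          rw [integral_add (hfi k) hsi, hshift]
          have := hf k; have := hf (-k)
          have h2 : (2 : ℝ) / N = 1 / N + 1 / N := by ring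
          linarith

end Box
theorem IsBddMeas.comp_continuous {Ω : Type*} [MeasurableSpace Ω] {f : Ω → ℝ} (hf : IsBddMeas f)
    {φ : ℝ → ℝ} (hφ : Continuous φ) : IsBddMeas fun ω => φ (f ω) := by
  obtain ⟨hm, C, hC⟩ := hf
  obtain ⟨D, hD⟩ := (isCompact_Icc (a := -C) (b := C)).exists_bound_of_continuousOn hφ.continuousOn
  exact ⟨hφ.measurable.comp hm, D, fun ω => hD _ (abs_le.1 (hC ω))⟩

/-- If `|a|` and `|b - a|` are at most `M / 2`, the remainder is `(b - a)² / 2`, and `v² ≤ 2 (v - (b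
- a))² + 2 (b - a)²` suffices. Otherwise `p v²` is at most `L` plus its excess over `L`, and a
Chebyshev bound pays for `L`. -/
theorem bregman_lower_bound {p M L : ℝ} (hp : 0 ≤ p) (hM : 0 < M) (hL : 0 ≤ L) (a b v : ℝ) :
    p * v ^ 2 / 4 - p * (v - (b - a)) ^ 2 / 2 - max (p * v ^ 2 - L) 0 / 4
        - L / (2 * M) * (|a| + |b - a|) ≤
      p * (truncPrim M b - truncPrim M a - (b - a) * trunc M a) := by
  have hmax : 0 ≤ max (p * v ^ 2 - L) 0 := le_max_right _ _
  have hmax' : p * v ^ 2 - L ≤ max (p * v ^ 2 - L) 0 := le_max_left _ _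
  have hLM : 0 ≤ L / (2 * M) := by positivity
  by_cases h : |a| ≤ M / 2 ∧ |b - a| ≤ M / 2
  · have hb : |b| ≤ M := by
      have := abs_add_le a (b - a)
      rw [add_sub_cancel] at this
      linarith [h.1, h.2]
    rw [truncPrim_bregman_eq (by linarith [h.1]) hb]
    have h1 : 0 ≤ L / (2 * M) * (|a| + |b - a|) := by positivity
    have h2 : 0 ≤ p * (v - 2 * (b - a)) ^ 2 := by positivity
    nlinarith
  · have h1 : M / 2 ≤ |a| + |b - a| := by
      by_contra! hlt
      exact h ⟨by linarith [abs_nonneg (b - a)], by linarith [abs_nonneg a]⟩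
    have h2 : L / 4 ≤ L / (2 * M) * (|a| + |b - a|) := by
      refine le_trans (le_of_eq ?_) (mul_le_mul_of_nonneg_left h1 hLM)
      field_simp
      norm_num
    have h3 := mul_nonneg hp (truncPrim_bregman_nonneg hM.le a b)
    have h4 : 0 ≤ p * (v - (b - a)) ^ 2 := by positivity
    linarith

section Prod

variable {X Y : Type*} [MeasurableSpace X] [MeasurableSpace Y] {μ : Measure X} {ν : Measure Y}
  [SFinite μ] [SFinite ν]

theorem abs_integral_prod_le {α : X → ℝ} {a : Y → ℝ} (hα : Integrable α μ) (ha : Integrable a ν)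
    {u : X × Y → ℝ} (hu : ∀ z, |u z| ≤ α z.1 * a z.2) :
    |∫ z, u z ∂(μ.prod ν)| ≤ (∫ x, α x ∂μ) * ∫ y, a y ∂ν := by
  rw [← integral_prod_mul, ← Real.norm_eq_abs]
  exact norm_integral_le_of_norm_le (hα.mul_prod ha) (Filter.Eventually.of_forall hu)

theorem integral_prod_of_integral_eq_one {θ : X → ℝ} (hθ : ∫ x, θ x ∂μ = 1) (a : Y → ℝ) :
    ∫ z, θ z.1 * a z.2 ∂(μ.prod ν) = ∫ y, a y ∂ν := by
  rw [integral_prod_mul, hθ, one_mul]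

end Prod

/-! ### Lattice increments of a potential. -/

section Spread

variable {d : ℕ} {Ω : Type*} [MeasurableSpace Ω] [AddAction (Fin d → ℤ) Ω]

/-- The increment of `f` over a lattice displacement, as a function on `ℤ^d × Ω`. -/
def spread (f : Ω → ℝ) (z : (Fin d → ℤ) × Ω) : ℝ := f z.2 - f (-z.1 +ᵥ z.2)

omit [MeasurableSpace Ω] in
theorem spread_vadd (f : Ω → ℝ) (k : Fin d → ℤ) (z : (Fin d → ℤ) × Ω) :
    spread f (k +ᵥ z) = f (k +ᵥ z.2) - f (-z.1 +ᵥ z.2) := by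
  change f (k +ᵥ z.2) - f (-(k + z.1) +ᵥ (k +ᵥ z.2)) = _
  rw [vadd_vadd]
  congr 3
  abel

omit [MeasurableSpace Ω] in
-- The diagonal action fixes the base point `-z.1 +ᵥ z.2`, so the increment acts as a potential that
-- is normalised at the lattice origin and has a stationary gradient.
theorem spread_vadd_sub (f : Ω → ℝ) (k : Step d) (z : (Fin d → ℤ) × Ω) :
    spread f (k.1 +ᵥ z) - spread f z = grad f k z.2 := by
  rw [spread_vadd, spread, grad]; ring

variable [MeasurableConstVAdd (Fin d → ℤ) Ω]

theorem isBddMeas_spread {f : Ω → ℝ} (hf : IsBddMeas f) : IsBddMeas (spread (d := d) f) := by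
  obtain ⟨hm, C, hC⟩ := hf
  refine ⟨(hm.comp measurable_snd).sub ?_, C + C, fun z =>
    (abs_sub _ _).trans (add_le_add (hC _) (hC _))⟩
  exact measurable_from_prod_countable_right fun x => hm.comp (measurable_const_vadd (-x))

variable {π : Measure Ω}

/-- The increment telescopes along a shortest lattice path. -/
theorem integral_abs_vadd_sub_le [VAddInvariantMeasure (Fin d → ℤ) Ω π] {g : Ω → ℝ}
    (hg : Integrable g π) {κ : ℝ} (hκ : ∀ k : Step d, ∫ ω, |grad g k ω| ∂π ≤ κ) (x : Fin d → ℤ) :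
    ∫ ω, |g (x +ᵥ ω) - g ω| ∂π ≤ (∑ i, |x i|).toNat * κ := by
  refine lattice_induction (P := fun x n => ∫ ω, |g (x +ᵥ ω) - g ω| ∂π ≤ n * κ) (by simp) ?_ x
  intro l x n hx
  have i1 : Integrable (fun ω => |grad g l (x +ᵥ ω)|) π :=
    integrable_vadd ((integrable_vadd hg l.1).sub hg).abs x
  have i2 : Integrable (fun ω => |g (x +ᵥ ω) - g ω|) π := ((integrable_vadd hg x).sub hg).abs
  calc ∫ ω, |g ((l.1 + x) +ᵥ ω) - g ω| ∂π
      ≤ ∫ ω, (|grad g l (x +ᵥ ω)| + |g (x +ᵥ ω) - g ω|) ∂π := by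
        refine integral_mono ((integrable_vadd hg _).sub hg).abs (i1.add i2) fun ω => ?_
        refine le_trans (le_of_eq ?_) (abs_add_le _ _)
        simp only [grad, add_vadd]; congr 1; ring
    _ ≤ (n + 1 : ℕ) * κ := by
        rw [integral_add i1 i2, integral_vadd (μ := π) fun ω => |grad g l ω|]
        push_cast
        linarith [hκ l]

theorem integral_spread_le [IsProbabilityMeasure π] [VAddInvariantMeasure (Fin d → ℤ) Ω π]
    {θ : (Fin d → ℤ) → ℝ} (hθ0 : ∀ x, 0 ≤ θ x) {n : ℕ} (hθn : ∀ x, θ x ≠ 0 → ∑ i, |x i| ≤ n)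
    (hθi : Integrable θ Measure.count) (hθ1 : ∫ x, θ x ∂Measure.count = 1)
    {g : Ω → ℝ} (hg : IsBddMeas g) {κ : ℝ} (hκ0 : 0 ≤ κ)
    (hκ : ∀ k : Step d, ∫ ω, |grad g k ω| ∂π ≤ κ) :
    ∫ z, θ z.1 * |spread g z| ∂(Measure.count.prod π) ≤ n * κ := by
  have hgi := memLp_one_iff_integrable.1 (hg.memLp (π := π) 1)
  have hi : Integrable (fun z : (Fin d → ℤ) × Ω => θ z.1 * |spread g z|)
      (Measure.count.prod π) := by
    have := ((isBddMeas_spread (d := d) hg).comp_continuous continuous_abs).integrable_mul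
      (hθi.mul_prod (integrable_const (μ := π) (1 : ℝ)))
    simpa using this
  rw [integral_prod _ hi, ← one_mul (n * κ), ← hθ1, ← integral_mul_const]
  refine integral_mono hi.integral_prod_left (hθi.mul_const _) fun x => ?_
  change ∫ ω, θ x * |spread g (x, ω)| ∂π ≤ θ x * (n * κ)
  rw [integral_const_mul]
  rcases eq_or_ne (θ x) 0 with h | h
  · rw [h, zero_mul, zero_mul]
  refine mul_le_mul_of_nonneg_left ?_ (hθ0 x)
  have h1 := integral_abs_vadd_sub_le hgi hκ (-x)
  have h2 : (∑ i, |(-x) i|).toNat ≤ n := by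
    have := hθn x h
    simp only [Pi.neg_apply, abs_neg]
    omega
  calc ∫ ω, |spread g (x, ω)| ∂π = ∫ ω, |g (-x +ᵥ ω) - g ω| ∂π := by
        congr 1; funext ω; rw [abs_sub_comm, spread]
    _ ≤ n * κ := h1.trans (mul_le_mul_of_nonneg_right (by exact_mod_cast h2) hκ0)

end Spread

/-! ### The localised energy estimate. -/

namespace Environment

variable {d : ℕ} {Ω : Type*} [MeasurableSpace Ω] [AddAction (Fin d → ℤ) Ω] {π : Measure Ω}
  {E : Environment d Ω π} [MeasurableConstVAdd (Fin d → ℤ) Ω]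

section Integrability

variable {k : Step d} {v : Step d → Ω → ℝ} (hv : MemLp (E.mulR v k) 2 π)
include hv

theorem aestronglyMeasurable_of_mulR : AEStronglyMeasurable (v k) π :=
  ((E.measurable_r k).inv.aestronglyMeasurable.mul hv.1).congr (mulRInv_mulR v k)

theorem integrable_p_mul_sq : Integrable (fun ω => E.p k ω * v k ω ^ 2) π := by
  refine (hv.integrable_sq.const_mul 2).mono' ((E.measurable_p k).aestronglyMeasurable.mul
    ((aestronglyMeasurable_of_mulR hv).pow 2)) (Filter.Eventually.of_forall fun ω => ?_)
  rw [Real.norm_of_nonneg (mul_nonneg (E.p_nonneg k ω) (sq_nonneg _)), mulR, mul_pow, r_sq,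
    ← mul_assoc]
  exact mul_le_mul_of_nonneg_right (E.p_le k ω) (sq_nonneg _)

theorem integral_p_mul_sq_le :
    ∫ ω, E.p k ω * v k ω ^ 2 ∂π ≤ 2 * ∫ ω, E.mulR v k ω ^ 2 ∂π := by
  rw [← integral_const_mul]
  refine integral_mono (integrable_p_mul_sq hv) (hv.integrable_sq.const_mul 2) fun ω => ?_
  simp only [mulR]
  rw [mul_pow, r_sq, ← mul_assoc]
  exact mul_le_mul_of_nonneg_right (E.p_le k ω) (sq_nonneg _)

variable (hr : ∀ k, MemLp (E.r k) 2 π)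
include hr

omit [MeasurableConstVAdd (Fin d → ℤ) Ω] in
theorem integrable_s_mul : Integrable (fun ω => E.s k ω * v k ω) π := by
  refine (integrable_mul_of_memLp_two (hr k) hv).congr (Filter.Eventually.of_forall fun ω => ?_)
  simp only [mulR]
  rw [← r_sq]; ring

omit [MeasurableConstVAdd (Fin d → ℤ) Ω] in
theorem integral_s_mul_abs_le :
    ∫ ω, E.s k ω * |v k ω| ∂π ≤ √(∫ ω, E.r k ω ^ 2 ∂π) * √(∫ ω, E.mulR v k ω ^ 2 ∂π) := by
  refine le_trans (le_of_eq ?_) (integral_abs_mul_le (hr k) hv)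
  congr 1; funext ω
  simp only [mulR]
  rw [← mul_assoc, ← sq, r_sq, abs_mul, abs_of_nonneg (E.s_nonneg k ω)]

theorem integrable_p_mul : Integrable (fun ω => E.p k ω * v k ω) π := by
  refine ((integrable_s_mul hv hr).const_mul 2).mono ((E.measurable_p k).aestronglyMeasurable.mul
    (aestronglyMeasurable_of_mulR hv)) (Filter.Eventually.of_forall fun ω => ?_)
  rw [norm_mul, norm_mul, norm_mul, ← mul_assoc, Real.norm_of_nonneg (E.p_nonneg k ω),
    Real.norm_of_nonneg (E.s_nonneg k ω), Real.norm_of_nonneg two_pos.le]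
  exact mul_le_mul_of_nonneg_right (E.p_le k ω) (norm_nonneg _)

theorem integral_p_mul_abs_le : ∫ ω, E.p k ω * |v k ω| ∂π ≤ 2 * ∫ ω, E.s k ω * |v k ω| ∂π := by
  rw [← integral_const_mul]
  have h1 : ∀ ω, E.p k ω * |v k ω| = |E.p k ω * v k ω| := fun ω => by
    rw [abs_mul, abs_of_nonneg (E.p_nonneg k ω)]
  have h2 : ∀ ω, E.s k ω * |v k ω| = |E.s k ω * v k ω| := fun ω => by
    rw [abs_mul, abs_of_nonneg (E.s_nonneg k ω)]
  refine integral_mono ?_ ?_ fun ω => ?_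
  · simp only [h1]; exact (integrable_p_mul hv hr).abs
  · simp only [h2]; exact (integrable_s_mul hv hr).abs.const_mul 2
  · change E.p k ω * |v k ω| ≤ 2 * (E.s k ω * |v k ω|)
    rw [← mul_assoc]
    exact mul_le_mul_of_nonneg_right (E.p_le k ω) (abs_nonneg _)

end Integrability

variable [IsProbabilityMeasure π] [VAddInvariantMeasure (Fin d → ℤ) Ω π]

/-- The flux of a truncated increment through the boundary of the localising function is small. -/
theorem localised_flux_le (hr : ∀ k, MemLp (E.r k) 2 π) (hh : ∀ k l, Integrable (E.h k l) π)
    {θ : (Fin d → ℤ) → ℝ} (hθi : Integrable θ Measure.count) {D : ℝ}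
    (hD : ∀ k : Step d, ∫ x, |θ (k.1 + x) - θ x| ∂Measure.count ≤ D)
    {f : Ω → ℝ} (hf : IsBddMeas f) {M : ℝ} (hM : 0 ≤ M) :
    ∑ k, ∫ z, E.p k z.2 * θ z.1 * grad (fun z => truncPrim M (spread f z)) k z
        ∂(Measure.count.prod π) ≤
      D * M / 2 * (∑ k, ∫ ω, E.s k ω * |grad f k ω| ∂π +
        ∑ k, ∑ l, ∫ ω, |E.h k l ω * grad f l ω| ∂π) := by
  have hS := isBddMeas_spread (d := d) hf
  have hF := hS.comp_continuous (continuous_truncPrim M)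
  have hθs : ∀ x : Fin d → ℤ, Integrable (fun y => θ (x + y)) Measure.count := fun x =>
    integrable_vadd (μ := (Measure.count : Measure (Fin d → ℤ))) hθi x
  -- The primitive is `M`-Lipschitz; each flux term then costs a factor `M` here and a factor `D`
  -- from the gradient of `θ`.
  have hgrad : ∀ (k : Step d) (z : (Fin d → ℤ) × Ω),
      |grad (fun z : (Fin d → ℤ) × Ω => truncPrim M (spread f z)) k z| ≤ M * |grad f k z.2| := by
    intro k z
    rw [← spread_vadd_sub]
    exact abs_truncPrim_sub_le hM _ _
  have key := sum_integral_p_mul_grad_localised (E := E.lift) (η := fun z => θ z.1)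
    (F := fun z => truncPrim M (spread f z))
    (fun k x => ((hθs x).mul_prod (E.integrable_p hr k)).congr
      (Filter.Eventually.of_forall fun z => mul_comm _ _))
    (fun k l x => ((hθs x).mul_prod (hh k l)).congr
      (Filter.Eventually.of_forall fun z => mul_comm _ _)) hF
  refine key.trans_le ?_
  have hdi : ∀ k : Step d, Integrable (fun x => |θ (k.1 + x) - θ x|) Measure.count := fun k =>
    ((hθs k.1).sub hθi).abs
  have hsi : ∀ k : Step d, Integrable (fun ω => E.s k ω * |grad f k ω|) π := fun k =>
    ((hf.grad k).comp_continuous continuous_abs).integrable_mul (E.integrable_s hr k)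
  have hhi : ∀ k l : Step d, Integrable (fun ω => |E.h k l ω * grad f l ω|) π := fun k l =>
    ((hf.grad l).integrable_mul (hh k l)).abs
  have hs0 : ∀ k : Step d, 0 ≤ ∫ ω, E.s k ω * |grad f k ω| ∂π := fun k =>
    integral_nonneg fun ω => mul_nonneg (E.s_nonneg k ω) (abs_nonneg _)
  have hh0 : ∀ k l : Step d, 0 ≤ ∫ ω, |E.h k l ω * grad f l ω| ∂π := fun k l =>
    integral_nonneg fun ω => abs_nonneg _
  have b1 : ∀ k, -∫ z, E.lift.s k z * grad (fun z => θ z.1) k z *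
      grad (fun z => truncPrim M (spread f z)) k z ∂(Measure.count.prod π) ≤
      D * M * ∫ ω, E.s k ω * |grad f k ω| ∂π := by
    intro k
    refine (neg_le_abs _).trans ((abs_integral_prod_le (hdi k) ((hsi k).const_mul M)
      fun z => ?_).trans ?_)
    · rw [abs_mul, abs_mul]
      calc _ ≤ E.s k z.2 * |θ (k.1 + z.1) - θ z.1| * (M * |grad f k z.2|) :=
            mul_le_mul (le_of_eq (congrArg₂ _ (abs_of_nonneg (E.s_nonneg k z.2)) rfl)) (hgrad k z)
              (abs_nonneg _) (mul_nonneg (E.s_nonneg k z.2) (abs_nonneg _))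
        _ = _ := by ring
    · rw [integral_const_mul, ← mul_assoc]
      exact mul_le_mul_of_nonneg_right (mul_le_mul_of_nonneg_right (hD k) hM) (hs0 k)
  have b2 : ∀ k l, ∫ z, E.lift.h k l z * grad (fun z => θ z.1) k (l.1 +ᵥ z) *
      grad (fun z => truncPrim M (spread f z)) l z ∂(Measure.count.prod π) ≤
      D * M * ∫ ω, |E.h k l ω * grad f l ω| ∂π := by
    intro k l
    have hli : Integrable (fun x => |θ (k.1 + (l.1 + x)) - θ (l.1 + x)|) Measure.count :=
      integrable_vadd (μ := (Measure.count : Measure (Fin d → ℤ))) (hdi k) l.1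
    have hlD : ∫ x, |θ (k.1 + (l.1 + x)) - θ (l.1 + x)| ∂Measure.count ≤ D :=
      (integral_vadd (μ := (Measure.count : Measure (Fin d → ℤ)))
        (fun x => |θ (k.1 + x) - θ x|) l.1).trans_le (hD k)
    refine (le_abs_self _).trans ((abs_integral_prod_le hli ((hhi k l).const_mul M)
      fun z => ?_).trans ?_)
    · rw [abs_mul, abs_mul]
      calc _ ≤ |E.h k l z.2| * |θ (k.1 + (l.1 + z.1)) - θ (l.1 + z.1)| * (M * |grad f l z.2|) :=
            mul_le_mul (le_of_eq rfl) (hgrad l z)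
              (abs_nonneg _) (mul_nonneg (abs_nonneg _) (abs_nonneg _))
        _ = _ := by rw [abs_mul]; ring
    · rw [integral_const_mul, ← mul_assoc]
      exact mul_le_mul_of_nonneg_right (mul_le_mul_of_nonneg_right hlD hM) (hh0 k l)
  have c1 := Finset.sum_le_sum fun k (_ : k ∈ Finset.univ) => b1 k
  have c2 := Finset.sum_le_sum fun k (_ : k ∈ Finset.univ) =>
    Finset.sum_le_sum fun l (_ : l ∈ Finset.univ) => b2 k l
  rw [Finset.sum_neg_distrib] at c1
  simp only [← Finset.mul_sum] at c1 c2
  linarith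

end Environment
theorem exists_integral_max_sub_le {Ω : Type*} [MeasurableSpace Ω] {π : Measure Ω} {g : Ω → ℝ}
    (hg : Integrable g π) (hg0 : ∀ ω, 0 ≤ g ω) {ε : ℝ} (hε : 0 < ε) :
    ∃ L₀ : ℝ, ∀ L ≥ L₀, ∫ ω, max (g ω - L) 0 ∂π ≤ ε := by
  have h : Filter.Tendsto (fun L : ℝ => ∫ ω, max (g ω - L) 0 ∂π) Filter.atTop
      (nhds (∫ _, (0 : ℝ) ∂π)) := by
    refine tendsto_integral_filter_of_dominated_convergence g ?_ ?_ hg ?_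
    · exact Filter.Eventually.of_forall fun L =>
        (hg.1.sub aestronglyMeasurable_const).sup aestronglyMeasurable_const
    · filter_upwards [Filter.eventually_ge_atTop 0] with L hL
      refine Filter.Eventually.of_forall fun ω => ?_
      rw [Real.norm_of_nonneg (le_max_right _ _)]
      exact max_le (by linarith) (hg0 ω)
    · refine Filter.Eventually.of_forall fun ω => ?_
      refine tendsto_const_nhds.congr' ?_
      filter_upwards [Filter.eventually_ge_atTop (g ω)] with L hL
      rw [max_eq_right (by linarith)]
  rw [integral_zero] at h
  obtain ⟨L₀, hL₀⟩ := Filter.eventually_atTop.1 (h.eventually (ge_mem_nhds hε))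
  exact ⟨L₀, hL₀⟩

namespace Environment

variable {d : ℕ} {Ω : Type*} [MeasurableSpace Ω] [AddAction (Fin d → ℤ) Ω] {π : Measure Ω}
  {E : Environment d Ω π} [MeasurableConstVAdd (Fin d → ℤ) Ω]

variable [IsProbabilityMeasure π] [VAddInvariantMeasure (Fin d → ℤ) Ω π]

/-- The localised energy estimate for a solution `w` of the homogeneous equation and an
approximate potential `f`. -/
theorem energy_le (hr : ∀ k, MemLp (E.r k) 2 π) (hh : ∀ k l, Integrable (E.h k l) π)
    {θ : (Fin d → ℤ) → ℝ} (hθ0 : ∀ x, 0 ≤ θ x) (hθi : Integrable θ Measure.count)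
    (hθ1 : ∫ x, θ x ∂Measure.count = 1) {D : ℝ}
    (hD : ∀ k : Step d, ∫ x, |θ (k.1 + x) - θ x| ∂Measure.count ≤ D)
    {w : Step d → Ω → ℝ} (hw : ∀ k, MemLp (E.mulR w k) 2 π)
    (hsol : ∀ᵐ ω ∂π, ∑ k, E.p k ω * w k ω = 0)
    {f : Ω → ℝ} (hf : IsBddMeas f) {M L : ℝ} (hM : 0 < M) (hL : 0 ≤ L) :
    ∑ k, ∫ ω, E.p k ω * w k ω ^ 2 ∂π ≤
      2 * ∑ k, ∫ ω, E.p k ω * (w k ω - grad f k ω) ^ 2 ∂π +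
      ∑ k, ∫ ω, max (E.p k ω * w k ω ^ 2 - L) 0 ∂π +
      2 * L / M * ∑ k : Step d, (∫ z, θ z.1 * |spread f z| ∂(Measure.count.prod π) +
        ∫ ω, |grad f k ω| ∂π) +
      2 * D * M * (∑ k, ∫ ω, E.s k ω * |grad f k ω| ∂π +
        ∑ k, ∑ l, ∫ ω, |E.h k l ω * grad f l ω| ∂π) +
      4 * M * ∑ k, ∫ ω, E.p k ω * |w k ω - grad f k ω| ∂π := by
  have he : ∀ k, MemLp (E.mulR (w - grad f) k) 2 π := fun k => by
    rw [mulR_sub]; exact (hw k).sub (E.memLp_mulR_grad hr hf k)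
  have hS := isBddMeas_spread (d := d) hf
  have hF := hS.comp_continuous (continuous_truncPrim M)
  have hT := hS.comp_continuous (continuous_trunc M)
  have iΦ : ∀ k : Step d, Integrable (fun z => E.p k z.2 * θ z.1 *
      grad (fun z : (Fin d → ℤ) × Ω => truncPrim M (spread f z)) k z)
      (Measure.count.prod π) := fun k =>
    (hF.grad k).integrable_mul ((hθi.mul_prod (E.integrable_p hr k)).congr
      (Filter.Eventually.of_forall fun z => mul_comm _ _))
  have iw : ∀ k : Step d, Integrable (fun z : (Fin d → ℤ) × Ω =>
      θ z.1 * (E.p k z.2 * w k z.2) * trunc M (spread f z)) (Measure.count.prod π) := fun k =>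
    hT.integrable_mul (hθi.mul_prod (integrable_p_mul (hw k) hr))
  have ie : ∀ k : Step d, Integrable (fun z : (Fin d → ℤ) × Ω =>
      θ z.1 * (E.p k z.2 * (w k z.2 - grad f k z.2)) * trunc M (spread f z))
      (Measure.count.prod π) := fun k =>
    hT.integrable_mul (hθi.mul_prod (integrable_p_mul (he k) hr))
  have iS : Integrable (fun z : (Fin d → ℤ) × Ω => θ z.1 * |spread f z|)
      (Measure.count.prod π) := by
    have := (hS.comp_continuous continuous_abs).integrable_mul
      (hθi.mul_prod (integrable_const (μ := π) (1 : ℝ)))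
    simpa using this
  have iq : ∀ k : Step d, Integrable (fun ω => E.p k ω * w k ω ^ 2) π := fun k =>
    integrable_p_mul_sq (hw k)
  have iqe : ∀ k : Step d, Integrable (fun ω => E.p k ω * (w k ω - grad f k ω) ^ 2) π := fun k =>
    integrable_p_mul_sq (he k)
  have im : ∀ k : Step d, Integrable (fun ω => max (E.p k ω * w k ω ^ 2 - L) 0) π := fun k =>
    ((iq k).sub (integrable_const L)).sup (integrable_const 0)
  have ig : ∀ k : Step d, Integrable (fun ω => |grad f k ω|) π := fun k =>
    memLp_one_iff_integrable.1 (((hf.grad k).comp_continuous continuous_abs).memLp 1)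
  -- This is the part of `bregman_lower_bound` that depends on the environment alone; averaging it
  -- with `θ` returns its integral over `Ω`.
  let G : Step d → Ω → ℝ := fun k ω => E.p k ω * w k ω ^ 2 / 4 -
    E.p k ω * (w k ω - grad f k ω) ^ 2 / 2 - max (E.p k ω * w k ω ^ 2 - L) 0 / 4 -
    L / (2 * M) * |grad f k ω|
  have iG1 : ∀ k, Integrable (fun ω => E.p k ω * w k ω ^ 2 / 4 -
      E.p k ω * (w k ω - grad f k ω) ^ 2 / 2) π := fun k => ((iq k).div_const 4).sub ((iqe k).div_const 2)
  have iG2 : ∀ k, Integrable (fun ω => E.p k ω * w k ω ^ 2 / 4 -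
      E.p k ω * (w k ω - grad f k ω) ^ 2 / 2 - max (E.p k ω * w k ω ^ 2 - L) 0 / 4) π := fun k =>
    (iG1 k).sub ((im k).div_const 4)
  have iG : ∀ k, Integrable (G k) π := fun k => (iG2 k).sub ((ig k).const_mul _)
  have hG : ∀ k, ∫ ω, G k ω ∂π = (∫ ω, E.p k ω * w k ω ^ 2 ∂π) / 4 -
      (∫ ω, E.p k ω * (w k ω - grad f k ω) ^ 2 ∂π) / 2 -
      (∫ ω, max (E.p k ω * w k ω ^ 2 - L) 0 ∂π) / 4 - L / (2 * M) * ∫ ω, |grad f k ω| ∂π := by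
    intro k
    simp only [G]
    rw [integral_sub (iG2 k) ((ig k).const_mul _), integral_sub (iG1 k) ((im k).div_const 4),
      integral_sub ((iq k).div_const 4) ((iqe k).div_const 2), integral_div, integral_div,
      integral_div, integral_const_mul]
  -- The linear part of the Bregman remainder is split by `∇f = w - (w - ∇f)`. The `w` part vanishes
  -- after summation over `k` by the homogeneous equation; the rest is an approximation error.
  have hk : ∀ k, ∫ ω, G k ω ∂π - L / (2 * M) * ∫ z, θ z.1 * |spread f z| ∂(Measure.count.prod π) ≤
      ∫ z, E.p k z.2 * θ z.1 *
        grad (fun z : (Fin d → ℤ) × Ω => truncPrim M (spread f z)) k z ∂(Measure.count.prod π) -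
      ∫ z, θ z.1 * (E.p k z.2 * w k z.2) * trunc M (spread f z) ∂(Measure.count.prod π) +
      ∫ z, θ z.1 * (E.p k z.2 * (w k z.2 - grad f k z.2)) * trunc M (spread f z)
        ∂(Measure.count.prod π) := by
    intro k
    rw [← integral_prod_of_integral_eq_one hθ1 (G k), ← integral_const_mul,
      ← integral_sub (hθi.mul_prod (iG k)) (iS.const_mul _), ← integral_sub (iΦ k) (iw k)]
    have hadd := integral_add ((iΦ k).sub (iw k)) (ie k)
    simp only [Pi.sub_apply] at hadd
    rw [← hadd]
    refine integral_mono ((hθi.mul_prod (iG k)).sub (iS.const_mul _))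
      (((iΦ k).sub (iw k)).add (ie k)) fun z => ?_
    have h1 := mul_le_mul_of_nonneg_left (bregman_lower_bound (E.p_nonneg k z.2) hM hL
      (spread f z) (spread f (k.1 +ᵥ z)) (w k z.2)) (hθ0 z.1)
    rw [spread_vadd_sub] at h1
    simp only [G]
    simp only [grad] at h1 ⊢
    linarith
  have hb0 : ∑ k, ∫ z, θ z.1 * (E.p k z.2 * w k z.2) * trunc M (spread f z)
      ∂(Measure.count.prod π) = 0 := by
    rw [← integral_finsetSum _ fun k _ => iw k]
    refine integral_eq_zero_of_ae ((ae_prod_count hsol).mono fun z h => ?_)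
    change ∑ k, θ z.1 * (E.p k z.2 * w k z.2) * trunc M (spread f z) = 0
    rw [← Finset.sum_mul, ← Finset.mul_sum, h]; ring
  have hc : ∀ k, ∫ z, θ z.1 * (E.p k z.2 * (w k z.2 - grad f k z.2)) * trunc M (spread f z)
      ∂(Measure.count.prod π) ≤ M * ∫ ω, E.p k ω * |w k ω - grad f k ω| ∂π := by
    intro k
    have habs : ∀ ω, E.p k ω * |w k ω - grad f k ω| = |E.p k ω * (w k ω - grad f k ω)| := fun ω => by
      rw [abs_mul, abs_of_nonneg (E.p_nonneg k ω)]
    have hi : Integrable (fun ω => M * (E.p k ω * |w k ω - grad f k ω|)) π := by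
      simp only [habs]; exact ((integrable_p_mul (he k) hr).abs).const_mul M
    refine (le_abs_self _).trans ((abs_integral_prod_le hθi hi fun z => ?_).trans ?_)
    · rw [habs, abs_mul, abs_mul, abs_of_nonneg (hθ0 z.1), mul_comm M, ← mul_assoc]
      exact mul_le_mul_of_nonneg_left (abs_trunc_le hM.le _)
        (mul_nonneg (hθ0 _) (abs_nonneg _))
    · rw [hθ1, one_mul, integral_const_mul]
  have hflux := localised_flux_le hr hh hθi hD hf hM.le
  have hsum := Finset.sum_le_sum fun k (_ : k ∈ Finset.univ) => hk k
  have hsumc := Finset.sum_le_sum fun k (_ : k ∈ Finset.univ) => hc k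
  simp only [hG, Finset.sum_add_distrib, Finset.sum_sub_distrib, ← Finset.mul_sum,
    ← Finset.sum_div] at hsum hsumc
  rw [hb0] at hsum
  rw [Finset.sum_add_distrib]
  have hLM : 2 * L / M = 4 * (L / (2 * M)) := by field_simp; ring
  rw [hLM]
  linarith

omit [VAddInvariantMeasure (Fin d → ℤ) Ω π] in
/-- Constants controlling the error terms in `energy_le`. -/
theorem exists_error_bound (hr : ∀ k, MemLp (E.r k) 2 π)
    (hh : ∀ k l, MemLp (fun ω => (E.r l ω)⁻¹ * E.h k l ω) 2 π)
    {w : Step d → Ω → ℝ} (hw : ∀ k, MemLp (E.mulR w k) 2 π) (hwi : ∀ k, Integrable (w k) π) :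
    ∃ C > 0, ∀ f : Ω → ℝ, IsBddMeas f → ∀ δ : ℝ, 0 < δ → δ ≤ 1 →
      (∀ k, ∫ ω, E.mulR (w - grad f) k ω ^ 2 ∂π ≤ δ ^ 2) →
      (∀ k, ∫ ω, |w k ω - grad f k ω| ∂π ≤ 1) →
      ∑ k, ∫ ω, E.p k ω * (w k ω - grad f k ω) ^ 2 ∂π ≤ C * δ ∧
      ∑ k, ∫ ω, E.p k ω * |w k ω - grad f k ω| ∂π ≤ C * δ ∧
      ∑ k, ∫ ω, E.s k ω * |grad f k ω| ∂π +
        ∑ k, ∑ l, ∫ ω, |E.h k l ω * grad f l ω| ∂π ≤ C ∧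
      ∑ k : Step d, ∫ ω, |grad f k ω| ∂π ≤ C := by
  let n : ℝ := ∑ _ : Step d, (1 : ℝ)
  let a : ℝ := ∑ k, √(∫ ω, E.r k ω ^ 2 ∂π)
  let c : ℝ := ∑ k, ∑ l, √(∫ ω, ((E.r l ω)⁻¹ * E.h k l ω) ^ 2 ∂π)
  -- This bounds `‖R∇f‖` for every admissible `f`: the summand `2` comes from `2 * δ ^ 2 ≤ 2`.
  let u : ℝ := ∑ k, √(2 * ∫ ω, E.mulR w k ω ^ 2 ∂π + 2)
  let W : ℝ := ∑ k, ∫ ω, |w k ω| ∂π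
  have hn : 0 ≤ n := Finset.sum_nonneg fun _ _ => zero_le_one
  have ha : 0 ≤ a := Finset.sum_nonneg fun _ _ => Real.sqrt_nonneg _
  have hc : 0 ≤ c := Finset.sum_nonneg fun _ _ => Finset.sum_nonneg fun _ _ => Real.sqrt_nonneg _
  have hu : 0 ≤ u := Finset.sum_nonneg fun _ _ => Real.sqrt_nonneg _
  have hW : 0 ≤ W := Finset.sum_nonneg fun _ _ => integral_nonneg fun _ => abs_nonneg _
  refine ⟨2 * n + 2 * a + (a * u + c * u) + (W + n) + 1, by positivity,
    fun f hf δ hδ hδ1 hR hL => ?_⟩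
  have hRf : ∀ k, MemLp (E.mulR (grad f) k) 2 π := E.memLp_mulR_grad hr hf
  have he : ∀ k, MemLp (E.mulR (w - grad f) k) 2 π := fun k => by
    rw [mulR_sub]; exact (hw k).sub (hRf k)
  have hsqrt : ∀ k, √(∫ ω, E.mulR (w - grad f) k ω ^ 2 ∂π) ≤ δ := fun k =>
    Real.sqrt_le_iff.2 ⟨hδ.le, hR k⟩
  have hδ2 : δ ^ 2 ≤ δ := by nlinarith
  have hfu : ∀ k, √(∫ ω, E.mulR (grad f) k ω ^ 2 ∂π) ≤ u := by
    intro k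
    have h1 : ∫ ω, E.mulR (grad f) k ω ^ 2 ∂π ≤ 2 * ∫ ω, E.mulR w k ω ^ 2 ∂π +
        2 * ∫ ω, E.mulR (w - grad f) k ω ^ 2 ∂π := by
      rw [← integral_const_mul, ← integral_const_mul, ← integral_add
        ((hw k).integrable_sq.const_mul 2) ((he k).integrable_sq.const_mul 2)]
      refine integral_mono (hRf k).integrable_sq (((hw k).integrable_sq.const_mul 2).add
        ((he k).integrable_sq.const_mul 2)) fun ω => ?_
      simp only [mulR_sub, Pi.sub_apply]
      linarith [sq_nonneg (2 * E.mulR w k ω - E.mulR (grad f) k ω)]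
    refine (Real.sqrt_le_sqrt (h1.trans ?_)).trans (Finset.single_le_sum
      (f := fun k => √(2 * ∫ ω, E.mulR w k ω ^ 2 ∂π + 2)) (fun _ _ => Real.sqrt_nonneg _)
      (Finset.mem_univ k))
    linarith [hR k]
  have e1 : ∑ k, ∫ ω, E.p k ω * (w k ω - grad f k ω) ^ 2 ∂π ≤ 2 * n * δ := by
    simp only [n]
    rw [Finset.mul_sum, Finset.sum_mul]
    refine Finset.sum_le_sum fun k _ => (integral_p_mul_sq_le (he k)).trans ?_
    linarith [hR k]
  have e2 : ∑ k, ∫ ω, E.p k ω * |w k ω - grad f k ω| ∂π ≤ 2 * a * δ := by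
    simp only [a]
    rw [Finset.mul_sum, Finset.sum_mul]
    refine Finset.sum_le_sum fun k _ => (integral_p_mul_abs_le (he k) hr).trans ?_
    rw [mul_assoc]
    refine mul_le_mul_of_nonneg_left ?_ two_pos.le
    exact (integral_s_mul_abs_le (he k) hr).trans
      (mul_le_mul_of_nonneg_left (hsqrt k) (Real.sqrt_nonneg _))
  have e3 : ∑ k, ∫ ω, E.s k ω * |grad f k ω| ∂π ≤ a * u := by
    rw [Finset.sum_mul]
    exact Finset.sum_le_sum fun k _ => (integral_s_mul_abs_le (hRf k) hr).trans
      (mul_le_mul_of_nonneg_left (hfu k) (Real.sqrt_nonneg _))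
  -- Square integrability of `r_l⁻¹ h_{k,l}` serves here: it pairs with the energy bound on `r_l ∇_l
  -- f`.
  have e4 : ∑ k, ∑ l, ∫ ω, |E.h k l ω * grad f l ω| ∂π ≤ c * u := by
    simp only [c, Finset.sum_mul]
    refine Finset.sum_le_sum fun k _ => Finset.sum_le_sum fun l _ => ?_
    refine le_trans (le_of_eq ?_) ((integral_abs_mul_le (hh k l) (hRf l)).trans
      (mul_le_mul_of_nonneg_left (hfu l) (Real.sqrt_nonneg _)))
    refine integral_congr_ae ((E.r_pos l).mono fun ω h => ?_)
    simp only [mulR]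
    congr 1
    field_simp
  have e5 : ∑ k : Step d, ∫ ω, |grad f k ω| ∂π ≤ W + n := by
    simp only [W, n]
    rw [← Finset.sum_add_distrib]
    refine Finset.sum_le_sum fun k _ => ?_
    have ig : Integrable (fun ω => grad f k ω) π := memLp_one_iff_integrable.1 ((hf.grad k).memLp 1)
    have ie : Integrable (fun ω => |w k ω - grad f k ω|) π := ((hwi k).sub ig).abs
    calc ∫ ω, |grad f k ω| ∂π ≤ ∫ ω, (|w k ω| + |w k ω - grad f k ω|) ∂π := by
          refine integral_mono ig.abs ((hwi k).abs.add ie) fun ω => ?_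
          refine le_trans (le_of_eq ?_) (abs_sub _ _)
          congr 1; ring
      _ ≤ _ := by
          rw [integral_add (hwi k).abs ie]
          linarith [hL k]
  have p1 := mul_nonneg ha hu
  have p2 := mul_nonneg hc hu
  refine ⟨e1.trans (mul_le_mul_of_nonneg_right (by linarith) hδ.le),
    e2.trans (mul_le_mul_of_nonneg_right (by linarith) hδ.le), by linarith, by linarith⟩

end Environment
-- Vanishing of the energy and uniqueness.
namespace Environment

variable {d : ℕ} {Ω : Type*} [MeasurableSpace Ω] [AddAction (Fin d → ℤ) Ω] {π : Measure Ω}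
  {E : Environment d Ω π} [MeasurableConstVAdd (Fin d → ℤ) Ω]
  [IsProbabilityMeasure π] [VAddInvariantMeasure (Fin d → ℤ) Ω π]

/-- The final potential `f` is chosen after the box, so its sup norm is not controlled. Comparison
with a fixed `f₀` gives a constant plus a small slope times the diameter, which expresses
sublinearity. -/
theorem integral_spread_le_of_close {θ : (Fin d → ℤ) → ℝ} (hθ0 : ∀ x, 0 ≤ θ x) {n : ℕ}
    (hθn : ∀ x, θ x ≠ 0 → ∑ i, |x i| ≤ n) (hθi : Integrable θ Measure.count)
    (hθ1 : ∫ x, θ x ∂Measure.count = 1) {w : Step d → Ω → ℝ} (hwi : ∀ k, Integrable (w k) π)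
    {f f₀ : Ω → ℝ} (hf : IsBddMeas f) (hf₀ : IsBddMeas f₀) {B κ : ℝ} (hB : ∀ ω, |f₀ ω| ≤ B)
    (hκ0 : 0 ≤ κ) (hκ : ∀ k, ∫ ω, |w k ω - grad f k ω| ∂π ≤ κ)
    (hκ₀ : ∀ k, ∫ ω, |w k ω - grad f₀ k ω| ∂π ≤ κ) :
    ∫ z, θ z.1 * |spread f z| ∂(Measure.count.prod π) ≤ 2 * B + n * (2 * κ) := by
  have hg : IsBddMeas (f - f₀) := Submodule.sub_mem (boundedMeasurable Ω) hf hf₀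
  have hgi : ∀ {g : Ω → ℝ}, IsBddMeas g → ∀ k : Step d, Integrable (grad g k) π := fun hg k =>
    memLp_one_iff_integrable.1 ((hg.grad k).memLp 1)
  have h1 := integral_spread_le (π := π) hθ0 hθn hθi hθ1 hg (κ := 2 * κ) (by positivity) fun k => by
    have i1 := ((hwi k).sub (hgi hf k)).abs
    have i2 := ((hwi k).sub (hgi hf₀ k)).abs
    calc ∫ ω, |grad (f - f₀) k ω| ∂π
        ≤ ∫ ω, (|w k ω - grad f₀ k ω| + |w k ω - grad f k ω|) ∂π := by
          refine integral_mono (hgi hg k).abs (i2.add i1) fun ω => ?_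
          refine le_trans (le_of_eq ?_) (abs_sub _ _)
          simp only [grad, Pi.sub_apply]; congr 1; ring
      _ ≤ 2 * κ := by
          refine (integral_add i2 i1).trans_le ?_
          have := hκ k; have := hκ₀ k
          simp only [Pi.sub_apply]
          linarith
  have i3 : Integrable (fun z : (Fin d → ℤ) × Ω => θ z.1 * |spread (f - f₀) z|)
      (Measure.count.prod π) := by
    have := ((isBddMeas_spread (d := d) hg).comp_continuous continuous_abs).integrable_mul
      (hθi.mul_prod (integrable_const (μ := π) (1 : ℝ)))
    simpa using this
  have i4 : Integrable (fun z : (Fin d → ℤ) × Ω => θ z.1 * (2 * B)) (Measure.count.prod π) :=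
    hθi.mul_prod (integrable_const (μ := π) (2 * B))
  calc ∫ z, θ z.1 * |spread f z| ∂(Measure.count.prod π)
      ≤ ∫ z, (θ z.1 * (2 * B) + θ z.1 * |spread (f - f₀) z|) ∂(Measure.count.prod π) := by
        refine integral_mono_of_nonneg (Filter.Eventually.of_forall fun z =>
          mul_nonneg (hθ0 _) (abs_nonneg _)) (i4.add i3) (Filter.Eventually.of_forall fun z => ?_)
        change θ z.1 * |spread f z| ≤ θ z.1 * (2 * B) + θ z.1 * |spread (f - f₀) z|
        rw [← mul_add]
        refine mul_le_mul_of_nonneg_left ?_ (hθ0 _)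
        have e : spread f z = (f₀ z.2 - f₀ (-z.1 +ᵥ z.2)) + spread (f - f₀) z := by
          simp only [spread, Pi.sub_apply]; ring
        rw [e]
        refine (abs_add_le _ _).trans (add_le_add_left ((abs_sub _ _).trans ?_) _)
        linarith [hB z.2, hB (-z.1 +ᵥ z.2)]
    _ ≤ 2 * B + n * (2 * κ) := by
        rw [integral_add i4 i3, integral_prod_of_integral_eq_one hθ1 fun _ : Ω => 2 * B]
        simp only [integral_const, probReal_univ, one_smul]
        linarith

/-- The energy of a solution of the homogeneous equation vanishes. -/
theorem EnergyLimit.energy_eq_zero (hr : ∀ k, MemLp (E.r k) 2 π)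
    (hrinv : ∀ k, MemLp (fun ω => (E.r k ω)⁻¹) 2 π)
    (hh : ∀ k l, MemLp (fun ω => (E.r l ω)⁻¹ * E.h k l ω) 2 π) {w : Step d → Ω → ℝ}
    (hw : E.EnergyLimit w) (hsol : ∀ᵐ ω ∂π, ∑ k, E.p k ω * w k ω = 0) :
    ∑ k, ∫ ω, E.p k ω * w k ω ^ 2 ∂π ≤ 0 := by
  have hwi : ∀ k, Integrable (w k) π := fun k => integrable_of_memLp_mulR hrinv (hw.memLp k)
  have hhi : ∀ k l, Integrable (E.h k l) π := fun k l =>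
    (integrable_mul_of_memLp_two (hr l) (hh k l)).congr
      ((E.r_pos l).mono fun ω h => mul_inv_cancel_left₀ h.ne' _)
  obtain ⟨C, hC, herr⟩ := exists_error_bound hr hh hw.memLp hwi
  -- The errors are budgeted in units of `A / 8`: one for the tail, two for the increments, one for
  -- the flux, one for both approximation errors. The total `5 * A / 8` contradicts `A > 0`.
  by_contra! hA
  set A := ∑ k, ∫ ω, E.p k ω * w k ω ^ 2 ∂π with hAdef
  set n : ℝ := (Fintype.card (Step d) : ℝ) with hn
  have hn0 : 0 ≤ n := Nat.cast_nonneg _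
  -- the truncation level of the energy density
  choose L₀ hL₀ using fun k => exists_integral_max_sub_le (integrable_p_mul_sq (hw.memLp k))
    (fun ω => mul_nonneg (E.p_nonneg k ω) (sq_nonneg _)) (ε := A / (8 * (n + 1))) (by positivity)
  obtain ⟨L, hL0, hL⟩ : ∃ L : ℝ, 0 ≤ L ∧ ∀ k, L₀ k ≤ L :=
    ⟨∑ k, |L₀ k|, Finset.sum_nonneg fun _ _ => abs_nonneg _, fun k => (le_abs_self _).trans
      (Finset.single_le_sum (f := fun k => |L₀ k|) (fun _ _ => abs_nonneg _) (Finset.mem_univ k))⟩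
  have htail : ∑ k, ∫ ω, max (E.p k ω * w k ω ^ 2 - L) 0 ∂π ≤ A / 8 := by
    refine (Finset.sum_le_sum fun k _ => hL₀ k L (hL k)).trans ?_
    rw [Finset.sum_const, nsmul_eq_mul, Finset.card_univ, ← hn, mul_div_assoc',
      div_le_div_iff₀ (by positivity) (by positivity)]
    nlinarith
  -- the slope, the auxiliary potential, the size of the box, the final potential
  obtain ⟨ε, hε, hεC⟩ : ∃ ε > 0, 4 * ε * C = A / 8 :=
    ⟨A / (32 * C), by positivity, by field_simp; norm_num⟩
  -- Dividing the slope term by `M = ε * N` cancels `N`, so `κ` is fixed before `N`. The bound `B`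
  -- of `f₀` then depends on `κ` alone and is absorbed by a large `N`.
  obtain ⟨κ, hκ, hκA⟩ : ∃ κ > 0, 4 * L * n * d * κ / ε ≤ A / 8 := by
    refine ⟨A * ε / (32 * (L * n * d + 1)), by positivity, ?_⟩
    have h0 : 0 ≤ L * n * d := by positivity
    rw [div_le_iff₀ hε, mul_div_assoc', div_le_iff₀ (by positivity)]
    nlinarith [mul_pos hA hε, mul_nonneg h0 (mul_pos hA hε).le]
  obtain ⟨f₀, hf₀, -, hf₀κ⟩ := hw.exists_approx hr hrinv hκ
  obtain ⟨B, hB⟩ := hf₀.bound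
  obtain ⟨N, hN⟩ := exists_nat_gt (max 0 (16 * L * (2 * n * B + C) / (ε * A)))
  have hN0 : (0 : ℝ) < N := (le_max_left _ _).trans_lt hN
  have hNA : 2 * L * (2 * n * B + C) / (ε * N) ≤ A / 8 := by
    have h1 := ((le_max_right _ _).trans_lt hN).le
    rw [div_le_iff₀ (by positivity)] at h1 ⊢
    linarith
  obtain ⟨θ, hθ0, hθn, hθi, hθ1, hθD⟩ := exists_folner d (N := N) (by exact_mod_cast hN0)
  set M := ε * N with hM
  have hM0 : 0 < M := by positivity
  -- The approximation error is multiplied by `M`, so `δ` and `f` come last.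
  obtain ⟨δ, hδ, hδ1, hδA⟩ : ∃ δ > 0, δ ≤ 1 ∧ (2 + 4 * M) * (C * δ) ≤ A / 8 := by
    refine ⟨min 1 (A / (8 * (2 + 4 * M) * C)), by positivity, min_le_left _ _, ?_⟩
    refine (mul_le_mul_of_nonneg_left (mul_le_mul_of_nonneg_left (min_le_right _ _) hC.le)
      (by positivity)).trans_eq ?_
    field_simp
  obtain ⟨f, hf, hfδ, hfκ⟩ := hw.exists_approx hr hrinv (ε := min (δ ^ 2) (min κ 1))
    (by positivity)
  obtain ⟨e1, e2, e3, e4⟩ := herr f hf δ hδ hδ1 (fun k => (hfδ k).trans (min_le_left _ _))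
    fun k => (hfκ k).trans ((min_le_right _ _).trans (min_le_right _ _))
  have hspread := integral_spread_le_of_close hθ0 (n := d * N)
    (fun x hx => by exact_mod_cast hθn x hx) hθi hθ1 hwi hf hf₀ hB hκ.le
    (fun k => (hfκ k).trans ((min_le_right _ _).trans (min_le_left _ _))) hf₀κ
  have key := energy_le hr hhi hθ0 hθi hθ1 hθD hw.memLp hsol hf hM0 hL0
  rw [← hAdef, Finset.sum_add_distrib, Finset.sum_const, nsmul_eq_mul, Finset.card_univ,
    ← hn] at key
  have t3 : 2 * L / M * (n * ∫ z, θ z.1 * |spread f z| ∂(Measure.count.prod π) +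
      ∑ k : Step d, ∫ ω, |grad f k ω| ∂π) ≤ A / 8 + A / 8 := by
    have h1 : n * ∫ z, θ z.1 * |spread f z| ∂(Measure.count.prod π) +
        ∑ k : Step d, ∫ ω, |grad f k ω| ∂π ≤ (2 * n * B + C) + 2 * n * d * κ * N := by
      have := mul_le_mul_of_nonneg_left hspread hn0
      push_cast at this
      linarith
    refine (mul_le_mul_of_nonneg_left h1 (by positivity)).trans ?_
    have h2 : 2 * L / M * ((2 * n * B + C) + 2 * n * d * κ * N) =
        2 * L * (2 * n * B + C) / M + 4 * L * n * d * κ / ε := by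
      rw [hM]; field_simp; ring
    rw [h2]
    exact add_le_add hNA hκA
  have t4 : 2 * (2 / N) * M * (∑ k, ∫ ω, E.s k ω * |grad f k ω| ∂π +
      ∑ k, ∑ l, ∫ ω, |E.h k l ω * grad f l ω| ∂π) ≤ A / 8 := by
    have h1 : 2 * (2 / (N : ℝ)) * M = 4 * ε := by rw [hM]; field_simp; norm_num
    rw [h1, ← hεC]
    exact mul_le_mul_of_nonneg_left e3 (by positivity)
  have t5 := mul_le_mul_of_nonneg_left e2 (by positivity : 0 ≤ 4 * M)
  linarith

theorem EnergyLimit.eq_zero (hr : ∀ k, MemLp (E.r k) 2 π)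
    (hrinv : ∀ k, MemLp (fun ω => (E.r k ω)⁻¹) 2 π)
    (hh : ∀ k l, MemLp (fun ω => (E.r l ω)⁻¹ * E.h k l ω) 2 π) {w : Step d → Ω → ℝ}
    (hw : E.EnergyLimit w) (hsol : ∀ᵐ ω ∂π, ∑ k, E.p k ω * w k ω = 0) (k : Step d) :
    w k =ᵐ[π] 0 := by
  have hnn : ∀ k ω, 0 ≤ E.p k ω * w k ω ^ 2 := fun k ω =>
    mul_nonneg (E.p_nonneg k ω) (sq_nonneg _)
  have h0 : ∀ k, ∀ᵐ ω ∂π, E.p k ω * w k ω ^ 2 = 0 := by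
    intro k
    have h1 := Finset.single_le_sum (f := fun k => ∫ ω, E.p k ω * w k ω ^ 2 ∂π)
      (fun k _ => integral_nonneg (hnn k)) (Finset.mem_univ k)
    exact (integral_eq_zero_iff_of_nonneg (hnn k) (integrable_p_mul_sq (hw.memLp k))).1
      (le_antisymm (h1.trans (hw.energy_eq_zero hr hrinv hh hsol)) (integral_nonneg (hnn k)))
  -- A single `p_k` may vanish. Adding the identities read from both ends of the bond gives `s_k
  -- w_k² = 0`, and `s_k > 0`.
  filter_upwards [h0 k, ae_vadd (h0 (-k)) k.1, (hw.memGradient hr hrinv).1.1.2 k,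
    E.weakly_elliptic k] with ω h1 h2 h3 h4
  rw [show w (-k) (k.1 +ᵥ ω) = -w k ω by linarith, neg_sq] at h2
  have h5 : (E.p k ω + E.p (-k) (k.1 +ᵥ ω)) / 2 * w k ω ^ 2 = 0 := by linarith
  exact pow_eq_zero_iff two_ne_zero |>.1 ((mul_eq_zero.1 h5).resolve_left h4.ne')

end Environment
end RWRE

theorem mainTheorem3 {d : ℕ} {Ω : Type*} [MeasurableSpace Ω] [AddAction (Fin d → ℤ) Ω]
    [MeasurableConstVAdd (Fin d → ℤ) Ω] (π : Measure Ω) [IsProbabilityMeasure π]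
    [ErgodicVAdd (Fin d → ℤ) Ω π] (E : RWRE.Environment d Ω π)
    (hr : ∀ k, MemLp (E.r k) 2 π)
    (hrinv : ∀ k, MemLp (fun ω => (E.r k ω)⁻¹) 2 π) :
    (∀ w : RWRE.Step d → Ω → ℝ, E.MemRInvK2 w → RWRE.MemGradient π 1 w) ∧
    (∀ φ : Ω → ℝ, E.MemHMinus φ →
      ∃ w : RWRE.Step d → Ω → ℝ, E.MemRInvK2 w ∧ E.SolvesHarmonic w φ ∧
        RWRE.normTwo π (E.mulR w) ≤ E.normMinus φ ∧
        RWRE.normOne π w ≤ RWRE.normTwo π (fun k ω => (E.r k ω)⁻¹) * E.normMinus φ) ∧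
    ((∀ k l, MemLp (fun ω => (E.r l ω)⁻¹ * E.h k l ω) 2 π) →
      ∀ φ : Ω → ℝ, E.MemHMinus φ → ∀ w w' : RWRE.Step d → Ω → ℝ,
        E.MemRInvK2 w → E.SolvesHarmonic w φ → E.MemRInvK2 w' → E.SolvesHarmonic w' φ →
          ∀ k, w k =ᵐ[π] w' k) := by
  refine ⟨fun w hw => (hw.energyLimit hr).memGradient hr hrinv, fun φ hφ => ?_,
    fun hh φ _ w w' hw hs hw' hs' k => ?_⟩
  · obtain ⟨w, hw, hs, hn⟩ := hφ.exists_solution hr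
    exact ⟨w, hw.memRInvK2 hr hrinv, hs, hn, (RWRE.Environment.normOne_le hrinv hw.memLp).trans
      (mul_le_mul_of_nonneg_left hn (RWRE.Environment.normTwo_nonneg _))⟩
  · have hd := (hw.energyLimit hr).sub hr (hw'.energyLimit hr)
    refine (hd.eq_zero hr hrinv hh ?_ k).mono fun ω h => sub_eq_zero.1 h
    filter_upwards [hs, hs'] with ω h1 h2
    simp only [Pi.sub_apply, mul_sub, Finset.sum_sub_distrib]
    rw [h1, h2, sub_self]
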